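/- Let $\Gamma$ be a graph (a finite CW complex of dimension at most $1$; self-loops and multiple edges are allowed) with vertex set $V$, edge set $E$ and half-edge set $H$. Write $v(h)$ and $e(h)$ for the vertex and the edge of a half-edge $h$, and $H(v)$ for the set of half-edges at $v$. The valence of $v$ is $|H(v)|$. The graph is smooth if the only bivalent vertices of $\Gamma$ are those carrying a self-loop; it has no isolated vertices if no vertex has valence $0$; a vertex is essential if its valence is at least $3$. For $S\subseteq V$, let $\pi_E(\Gamma\setminus S)$ be the set of equivalence classes of edges, where two edges are equivalent if they lie in the same connected component of $\Gamma\setminus S$. For smooth $\Gamma$ put $\Delta^i_\Gamma=\max_S|\pi_E(\Gamma\setminus S)|$, the maximum over all sets $S$ of $i$ vertices of valence at least $2$, and $\Delta^i_\Gamma=-\infty$ if there is no such $S$. Let $\mathbb F$ be a field. The reduced Świątkowski complex of a graph $\Gamma$ is $\widetilde S(\Gamma;\mathbb F)=\mathbb F[E]\otimes\bigotimes_{v\in V}\widetilde S(v)$, where $\widetilde S(v)$ is spanned by $\varnothing$ and the differences $h-h'$ with $h,h'\in H(v)$. It is bigraded by (degree, weight) with $|\varnothing|=(0,0)$, $|e|=(0,1)$,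 $|h|=(1,1)$, and has the $\mathbb F[E]$-linear differential determined by $\partial(h-h')=e(h)-e(h')$ and the Koszul sign rule. Let $W$ be a set of essential vertices of $\Gamma$. Let $\Gamma_W$ be the graph obtained from $\Gamma$ by exploding each $v\in W$, that is, by replacing $v$ with $|H(v)|$ univalent vertices, one for each half-edge at $v$; it has the same edges as $\Gamma$. Let $E_W$ be the quotient of $E$ by the equivalence relation generated by identifying any two edges that share a vertex of $W$ (so $E_\varnothing=E$), and let $$\widetilde S_W(\Gamma;\mathbb F)=\widetilde S(\Gamma_W;\mathbb F)\otimes_{\mathbb F[E]}\mathbb F[E_W],$$ bigraded with the elements of $E_W$ in degree $0$ and weight $1$; thus $\widetilde S_\varnothing(\Gamma;\mathbb F)=\widetilde S(\Gamma;\mathbb F)$. **Proposition.** Let $\Gamma$ be smooth with no isolated vertices, let $W$ be a set of essential vertices of $\Gamma$, let $\mathbb F$ be a field and let $i\ge 0$. Then the dimension over $\mathbb F$ of the weight $k$ part of $H_i(\widetilde S_W(\Gamma;\mathbb F))$ is, for all sufficiently large $k$, finite and equal to the value at $k$ of a polynomial with rational coefficients of degree at most $\Delta^i_\Gamma-1$.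 (If $\Delta^i_\Gamma\in\{0,-\infty\}$, this means that the dimension is eventually $0$.) -/

import Mathlib

open scoped TensorProduct

universe u v

/-- A finite one-dimensional CW complex, given by its vertices, edges and half-edges (ends of
edges). Every edge has exactly two half-edges; self-loops and multiple edges are allowed. -/
structure FinGraph : Type (u + 1) where
  V : Type u
  E : Type u
  H : Type u
  [fintypeV : Fintype V]
  [fintypeE : Fintype E]
  [fintypeH : Fintype H]
  /-- the vertex at which a half-edge is attached -/
  vert : H → V
  /-- the edge of which a half-edge is an end -/
  edge : H → E
  two_ends : ∀ e : E, Nat.card {h : H // edge h = e} = 2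

namespace FinGraph

attribute [instance] FinGraph.fintypeV FinGraph.fintypeE FinGraph.fintypeH

/-- The valence of a vertex: the number of half-edges at it (a self-loop counts twice). -/
noncomputable def valence (Γ : FinGraph.{u}) (x : Γ.V) : ℕ := Nat.card {h : Γ.H // Γ.vert h = x}

/-- A graph is smooth if it cannot be coarsened by forgetting a bivalent vertex. The only bivalent
vertices that cannot be forgotten are those carrying a self-loop (whose component is a cycle with
one vertex), so the condition is that the two half-edges at a bivalent vertex are the ends of one
and the same edge. -/
def IsSmooth (Γ : FinGraph.{u}) : Prop :=
  ∀ h h' : Γ.H, Γ.vert h = Γ.vert h' → Γ.valence (Γ.vert h) = 2 → Γ.edge h = Γ.edge h'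

/-- No vertex has valence `0`. -/
def NoIsolatedVertices (Γ : FinGraph.{u}) : Prop := ∀ x : Γ.V, Γ.valence x ≠ 0

/-- Two (open) edges are related if they lie in the same connected component of the space
`Γ ∖ S`, that is, if they can be joined by a chain of edges in which consecutive edges share a
vertex outside `S`. -/
def edgeSetoid (Γ : FinGraph.{u}) (S : Set Γ.V) : Setoid Γ.E :=
  Relation.EqvGen.setoid fun e e' =>
    ∃ h h' : Γ.H, Γ.vert h = Γ.vert h' ∧ Γ.vert h ∉ S ∧ Γ.edge h = e ∧ Γ.edge h' = e'

/-- The set of connected components of `Γ ∖ S` that contain an edge. -/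
abbrev EdgeClass (Γ : FinGraph.{u}) (S : Set Γ.V) : Type u := Quotient (Γ.edgeSetoid S)

open Classical in
/-- For smooth `Γ`, the invariant `Δ_Γ^i`: the maximum, over the sets `S` of `i` vertices of
valence at least `2`, of the number of edge classes of `Γ ∖ S`; it is `⊥ = -∞` if `Γ` has fewer
than `i` vertices of valence at least `2`. -/
noncomputable def ramos (Γ : FinGraph.{u}) (i : ℕ) : WithBot ℕ :=
  ((Finset.univ.filter fun x : Γ.V => 2 ≤ Γ.valence x).powersetCard i).sup
    fun S => ((Nat.card (Γ.EdgeClass (S : Set Γ.V)) : ℕ) : WithBot ℕ)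

open Classical in
/-- The graph `Γ_W` obtained by exploding every vertex of `W`: each `x ∈ W` is replaced by one
vertex for each half-edge `h` at `x`, and `h` is attached to the vertex that it labels. The edges
and half-edges are unchanged. -/
noncomputable abbrev explode (Γ : FinGraph.{u}) (W : Set Γ.V) : FinGraph.{u} where
  V := {x : Γ.V // x ∉ W} ⊕ {h : Γ.H // Γ.vert h ∈ W}
  E := Γ.E
  H := Γ.H
  fintypeV := Fintype.ofFinite _
  vert h := if hW : Γ.vert h ∈ W then Sum.inr ⟨h, hW⟩ else Sum.inl ⟨Γ.vert h, hW⟩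
  edge := Γ.edge
  two_ends := Γ.two_ends

section ReducedComplex

variable (Γ : FinGraph.{u}) (R : Type v) [CommRing R]

/-- The polynomial ring `R[E]` on the edges. -/
abbrev EdgeRing : Type (max u v) := MvPolynomial Γ.E R

/-- The exterior algebra over `R[E]` on the set of half-edges. The tensor product over the vertices
`x` of the local states `⟨∅, h - h' : h, h' ∈ H(x)⟩`, with half-edges at different vertices
commuting up to the Koszul sign, is the submodule `reduced` of this algebra. -/
abbrev HalfEdgeAlgebra : Type (max u v) := ExteriorAlgebra (Γ.EdgeRing R) (Γ.H →₀ Γ.EdgeRing R)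

/-- The linear form `h ↦ e(h)` on half-edges. -/
noncomputable def edgeForm : Module.Dual (Γ.EdgeRing R) (Γ.H →₀ Γ.EdgeRing R) :=
  Finsupp.linearCombination (Γ.EdgeRing R) fun h => (MvPolynomial.X (Γ.edge h) : Γ.EdgeRing R)

/-- The `R[E]`-linear graded derivation of the exterior algebra with `∂(h - h') = e(h) - e(h')`. -/
noncomputable def halfEdgeDiff : Γ.HalfEdgeAlgebra R →ₗ[Γ.EdgeRing R] Γ.HalfEdgeAlgebra R :=
  CliffordAlgebra.contractLeft (Γ.edgeForm R)

/-- The data of `i` differences `f j - g j` of half-edges, each taken at one vertex, at `i`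
distinct vertices. -/
def IsState {i : ℕ} (f g : Fin i → Γ.H) : Prop :=
  (∀ j, Γ.vert (f j) = Γ.vert (g j)) ∧ Function.Injective fun j => Γ.vert (f j)

/-- The product `(f 0 - g 0) (f 1 - g 1) ⋯` of differences of half-edges. -/
noncomputable def state {i : ℕ} (f g : Fin i → Γ.H) : Γ.HalfEdgeAlgebra R :=
  ExteriorAlgebra.ιMulti (Γ.EdgeRing R) i fun j =>
    (Finsupp.single (f j) 1 - Finsupp.single (g j) 1 : Γ.H →₀ Γ.EdgeRing R)

/-- The reduced Świątkowski complex `S̃(Γ; R)` as an `R[E]`-module: the span of the products of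
differences of half-edges at distinct vertices. -/
noncomputable def reduced : Submodule (Γ.EdgeRing R) (Γ.HalfEdgeAlgebra R) :=
  Submodule.span _ {x | ∃ (i : ℕ) (f g : Fin i → Γ.H), Γ.IsState f g ∧ x = Γ.state R f g}

variable {Γ} in
theorem halfEdgeDiff_state {i : ℕ} (f g : Fin i → Γ.H) :
    Γ.halfEdgeDiff R (Γ.state R f g) ∈ Submodule.span (Γ.EdgeRing R)
      {x | ∃ (n : ℕ) (s : Fin n → Fin i), n + 1 = i ∧ Function.Injective s ∧
        x = Γ.state R (f ∘ s) (g ∘ s)} := by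
  induction i with
  | zero =>
    have : Γ.halfEdgeDiff R (Γ.state R f g) = 0 := by
      simp only [state, halfEdgeDiff, ExteriorAlgebra.ιMulti_zero_apply]
      exact CliffordAlgebra.contractLeft_one _ _
    rw [this]
    exact Submodule.zero_mem _
  | succ i ih =>
    have hs : Γ.state R f g = ExteriorAlgebra.ι (Γ.EdgeRing R)
        (Finsupp.single (f 0) 1 - Finsupp.single (g 0) 1 : Γ.H →₀ Γ.EdgeRing R) *
          Γ.state R (f ∘ Fin.succ) (g ∘ Fin.succ) := by
      simp only [state]
      rw [ExteriorAlgebra.ιMulti_succ_apply]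
      rfl
    have hd := CliffordAlgebra.contractLeft_ι_mul (d := Γ.edgeForm R)
      (Finsupp.single (f 0) 1 - Finsupp.single (g 0) 1 : Γ.H →₀ Γ.EdgeRing R)
      (Γ.state R (f ∘ Fin.succ) (g ∘ Fin.succ))
    rw [hs]
    refine (congrArg (· ∈ _) hd).mpr ?_
    refine Submodule.sub_mem _ (Submodule.smul_mem _ _ (Submodule.subset_span
      ⟨i, Fin.succ, rfl, Fin.succ_injective _, rfl⟩)) ?_
    have key : ∀ y ∈ Submodule.span (Γ.EdgeRing R)
        {x | ∃ (n : ℕ) (s : Fin n → Fin i), n + 1 = i ∧ Function.Injective s ∧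
          x = Γ.state R ((f ∘ Fin.succ) ∘ s) ((g ∘ Fin.succ) ∘ s)},
        ExteriorAlgebra.ι (Γ.EdgeRing R)
          (Finsupp.single (f 0) 1 - Finsupp.single (g 0) 1 : Γ.H →₀ Γ.EdgeRing R) * y ∈
        Submodule.span (Γ.EdgeRing R)
          {x | ∃ (n : ℕ) (s : Fin n → Fin (i + 1)), n + 1 = i + 1 ∧ Function.Injective s ∧
            x = Γ.state R (f ∘ s) (g ∘ s)} := by
      intro y hy
      induction hy using Submodule.span_induction with
      | mem y hy =>
        obtain ⟨n, s, hn, hinj, rfl⟩ := hy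
        refine Submodule.subset_span ⟨n + 1, Fin.cons 0 (Fin.succ ∘ s), by omega, ?_, ?_⟩
        · rw [Fin.cons_injective_iff]
          refine ⟨?_, (Fin.succ_injective _).comp hinj⟩
          rintro ⟨j, hj⟩
          exact Fin.succ_ne_zero _ hj
        · simp only [state]
          rw [ExteriorAlgebra.ιMulti_succ_apply]
          rfl
      | zero => rw [mul_zero]; exact Submodule.zero_mem _
      | add y z _ _ hy hz => rw [mul_add]; exact Submodule.add_mem _ hy hz
      | smul a y _ hy => rw [mul_smul_comm]; exact Submodule.smul_mem _ _ hy
    exact key _ (ih (f ∘ Fin.succ) (g ∘ Fin.succ))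

/-- The reduced complex is closed under the differential. -/
theorem halfEdgeDiff_mem (x : Γ.HalfEdgeAlgebra R) (hx : x ∈ Γ.reduced R) :
    Γ.halfEdgeDiff R x ∈ Γ.reduced R := by
  unfold reduced at hx
  induction hx using Submodule.span_induction with
  | mem x hx =>
    obtain ⟨i, f, g, hfg, rfl⟩ := hx
    refine Submodule.span_le.mpr ?_ (halfEdgeDiff_state R f g)
    rintro _ ⟨n, s, -, hs, rfl⟩
    exact Submodule.subset_span ⟨n, f ∘ s, g ∘ s, ⟨fun j => hfg.1 (s j), hfg.2.comp hs⟩, rfl⟩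
  | zero => rw [map_zero]; exact Submodule.zero_mem _
  | add x y _ _ hx hy => rw [map_add]; exact Submodule.add_mem _ hx hy
  | smul a x _ hx => rw [map_smul]; exact Submodule.smul_mem _ _ hx

/-- The differential of `S̃(Γ; R)`. -/
noncomputable def reducedDiff : Γ.reduced R →ₗ[Γ.EdgeRing R] Γ.reduced R :=
  (Γ.halfEdgeDiff R).restrict (Γ.halfEdgeDiff_mem R)

/-- The part of `S̃(Γ; R)` of degree `i` and weight `k`: edges have degree `0` and weight `1`,
half-edges have degree `1` and weight `1`. -/
noncomputable def reducedPart (i k : ℕ) : Submodule R (Γ.reduced R) :=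
  Submodule.span R {x | ∃ (p : Γ.EdgeRing R) (a : ℕ) (f g : Fin i → Γ.H),
    p.IsHomogeneous a ∧ a + i = k ∧ Γ.IsState f g ∧
      (x : Γ.HalfEdgeAlgebra R) = p • Γ.state R f g}

end ReducedComplex

section SinkComplex

variable (Γ : FinGraph.{u}) (W : Set Γ.V) (R : Type v) [CommRing R]

/-- The polynomial ring `R[E_W]`, where `E_W` is the quotient of the set of edges by the
equivalence relation generated by identifying any two edges that share a vertex of `W`; that is,
two edges are identified if they lie in the same component of the complement of the vertices not
in `W`. -/
abbrev SinkRing : Type (max u v) := MvPolynomial (Γ.EdgeClass Wᶜ) R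

/-- `R[E_W]` is an algebra over `R[E]`, an edge acting by its class. -/
noncomputable instance sinkAlgebra : Algebra ((Γ.explode W).EdgeRing R) (Γ.SinkRing W R) :=
  (MvPolynomial.rename (R := R) (Quotient.mk (Γ.edgeSetoid Wᶜ))).toRingHom.toAlgebra

instance sinkScalarTower : IsScalarTower R ((Γ.explode W).EdgeRing R) (Γ.SinkRing W R) :=
  IsScalarTower.of_algebraMap_eq' (RingHom.ext fun r =>
    (MvPolynomial.rename_C (Quotient.mk (Γ.edgeSetoid Wᶜ)) r).symm)

/-- The module underlying the complex `S̃_W(Γ; R) = S̃(Γ_W; R) ⊗_{R[E]} R[E_W]` (with the tensor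
factors in the other order). -/
abbrev SinkComplex : Type (max u v) :=
  Γ.SinkRing W R ⊗[(Γ.explode W).EdgeRing R] (Γ.explode W).reduced R

noncomputable instance sinkAddCommGroup : AddCommGroup (Γ.SinkComplex W R) :=
  TensorProduct.addCommGroup

noncomputable instance sinkModule : Module R (Γ.SinkComplex W R) :=
  TensorProduct.leftModule

instance sinkIsScalarTower : IsScalarTower R (Γ.SinkRing W R) (Γ.SinkComplex W R) :=
  TensorProduct.isScalarTower_left

/-- The differential `1 ⊗ ∂` of `S̃_W(Γ; R)`. -/
noncomputable def sinkDiff : Γ.SinkComplex W R →ₗ[R] Γ.SinkComplex W R :=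
  (((Γ.explode W).reducedDiff R).baseChange (Γ.SinkRing W R)).restrictScalars R

/-- The part of `S̃_W(Γ; R)` of degree `i` and weight `k`; edge classes have degree `0` and
weight `1`. -/
noncomputable def sinkPart (i k : ℕ) : Submodule R (Γ.SinkComplex W R) :=
  Submodule.span R {x | ∃ (q : Γ.SinkRing W R) (b : ℕ) (y : (Γ.explode W).reduced R) (c : ℕ),
    q.IsHomogeneous b ∧ y ∈ (Γ.explode W).reducedPart R i c ∧ b + c = k ∧
      x = q ⊗ₜ[(Γ.explode W).EdgeRing R] y}

/-- The cycles of degree `i` and weight `k` in `S̃_W(Γ; R)`. -/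
noncomputable def sinkCycles (i k : ℕ) : Submodule R (Γ.SinkComplex W R) :=
  Γ.sinkPart W R i k ⊓ LinearMap.ker (Γ.sinkDiff W R)

/-- The boundaries of degree `i` and weight `k` in `S̃_W(Γ; R)`. -/
noncomputable def sinkBoundaries (i k : ℕ) : Submodule R (Γ.SinkComplex W R) :=
  (Γ.sinkPart W R (i + 1) k).map (Γ.sinkDiff W R)

/-- The weight `k` part of the homology module `H_i(S̃_W(Γ; R))`. -/
abbrev SinkHomology (i k : ℕ) : Type (max u v) :=
  Γ.sinkCycles W R i k ⧸ (Γ.sinkBoundaries W R i k).submoduleOf (Γ.sinkCycles W R i k)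

end SinkComplex

end FinGraph

/-!
Write `A = F[E_W]`. Over `A`, the complex `S̃_W(Γ; F)` is a tensor product of complexes
`A⟨h - h'⟩ → A`, one for each vertex `x ∉ W`, and the homology in degree zero of the factor at `x`
is killed by the linear forms `e(h) - e(h')` with `h, h' ∈ H(x)`. On the chain level, multiplication
by such a form is homotopic, through `insertSub`, to a chain map `edgeSubMap` that acts on the
factor at `x` only and is zero on its part of degree zero. A composite of `i + 1` such maps at distinct
vertices therefore vanishes in degree `i`, as a state of degree `i` is empty at one of these
vertices; hence a product of `i + 1` forms at distinct vertices annihilates the homology in degree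
`i` (`prod_smul_mem_sinkBoundaries`).

Filtering a graded `A`-module with this property by the images of multiplication by the forms, one
reaches subquotients on which, for some set `T` of at most `i` vertices of valence at least two, all
forms at vertices outside `T` act as zero (`eventuallyPoly_hilb_of_prod`). On such a subquotient two
edges in the same component of `Γ ∖ T` act in the same way, so that it is a module over a polynomial
ring in `|π_E(Γ ∖ T)|` variables, a number that does not decrease when `T` is enlarged to a set of
exactly `i` vertices and is therefore at most `Δ_Γ^i`, and the Hilbert–Serre theorem
(`eventuallyPoly_hilb`) bounds the degree of its Hilbert polynomial by `Δ_Γ^i - 1`. If fewer than `i` vertices have valence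
at least two, there are no nonzero chains in degree `i`.

The Hilbert functions are computed for sequences of subspaces `N k` of one fixed `A`-module that the
variables send from `N k` to `N (k + 1)`. Subquotients are recorded as pairs of such sequences, and
the sequences need not be independent, so neither quotient modules nor direct sum decompositions
occur.
-/

/-! ### Eventually polynomial functions -/

/-- `f` eventually agrees with a polynomial of degree less than `d`, written in the basis of
binomial coefficients `k ↦ k.choose j`. -/
def EventuallyPoly (d : ℕ) (f : ℕ → ℚ) : Prop :=
  ∃ (c : ℕ → ℚ) (n : ℕ), ∀ k, n ≤ k → f k = ∑ j ∈ Finset.range d, c j * (k.choose j : ℚ)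

namespace EventuallyPoly

variable {d d' : ℕ} {f g : ℕ → ℚ}

theorem of_eventually_zero (n : ℕ) (h : ∀ k, n ≤ k → f k = 0) : EventuallyPoly d f :=
  ⟨0, n, fun k hk => by simp [h k hk]⟩

theorem add (hf : EventuallyPoly d f) (hg : EventuallyPoly d g) : EventuallyPoly d (f + g) := by
  obtain ⟨c, n, h⟩ := hf
  obtain ⟨c', n', h'⟩ := hg
  refine ⟨c + c', max n n', fun k hk => ?_⟩
  rw [Pi.add_apply, h k (by omega), h' k (by omega), ← Finset.sum_add_distrib]
  exact Finset.sum_congr rfl fun j _ => by rw [Pi.add_apply]; ring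

theorem neg (hf : EventuallyPoly d f) : EventuallyPoly d (-f) := by
  obtain ⟨c, n, h⟩ := hf
  refine ⟨-c, n, fun k hk => ?_⟩
  rw [Pi.neg_apply, h k hk, ← Finset.sum_neg_distrib]
  exact Finset.sum_congr rfl fun j _ => by rw [Pi.neg_apply]; ring

theorem mono (hf : EventuallyPoly d f) (hd : d ≤ d') : EventuallyPoly d' f := by
  obtain ⟨c, n, h⟩ := hf
  refine ⟨fun j => if j < d then c j else 0, n, fun k hk => ?_⟩
  rw [h k hk, ← Finset.sum_subset (Finset.range_mono hd)]
  · refine Finset.sum_congr rfl fun j hj => ?_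
    dsimp only
    rw [if_pos (Finset.mem_range.mp hj)]
  · intro j _ hj
    dsimp only
    rw [if_neg (fun h => hj (Finset.mem_range.mpr h)), zero_mul]

/-- Discrete integration raises the degree by one. -/
theorem of_diff (h : EventuallyPoly d fun k => f (k + 1) - f k) : EventuallyPoly (d + 1) f := by
  obtain ⟨c, n, h⟩ := h
  set g : ℕ → ℚ := fun k => ∑ j ∈ Finset.range d, c j * (k.choose (j + 1) : ℚ) with hg
  have hgd : ∀ k, g (k + 1) = g k + ∑ j ∈ Finset.range d, c j * (k.choose j : ℚ) := by
    intro k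
    rw [hg]
    dsimp only
    rw [← Finset.sum_add_distrib]
    refine Finset.sum_congr rfl fun j _ => ?_
    rw [Nat.choose_succ_succ]
    push_cast
    ring
  have hc : ∀ k, n ≤ k → f k - g k = f n - g n := by
    intro k hk
    induction k, hk using Nat.le_induction with
    | base => rfl
    | succ k hk ih => rw [← ih, hgd, ← h k hk]; ring
  refine ⟨fun j => if j = 0 then f n - g n else c (j - 1), n, fun k hk => ?_⟩
  rw [Finset.sum_range_succ']
  have := hc k hk
  simp only [Nat.succ_ne_zero, if_false, if_true, Nat.add_sub_cancel, Nat.choose_zero_right,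
    Nat.cast_one, mul_one]
  change f k = g k + (f n - g n)
  linarith

theorem shift (h : EventuallyPoly d f) : EventuallyPoly d fun k => f (k + 1) := by
  obtain ⟨c, n, h⟩ := h
  cases d with
  | zero => exact of_eventually_zero n fun k hk => by simpa using h (k + 1) (by omega)
  | succ d =>
    refine ⟨fun j => c j + if j < d then c (j + 1) else 0, n, fun k hk => ?_⟩
    dsimp only
    rw [h (k + 1) (by omega)]
    simp only [add_mul, Finset.sum_add_distrib]
    rw [Finset.sum_range_succ (fun j => (if j < d then c (j + 1) else 0) * (k.choose j : ℚ)),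
      Finset.sum_range_succ' _ d, Finset.sum_range_succ' _ d, if_neg (lt_irrefl d), zero_mul,
      add_zero, Nat.choose_zero_right, Nat.choose_zero_right, add_right_comm,
      ← Finset.sum_add_distrib]
    congr 1
    refine Finset.sum_congr rfl fun j hj => ?_
    rw [if_pos (Finset.mem_range.mp hj), Nat.choose_succ_succ]
    push_cast
    ring

theorem exists_polynomial (h : EventuallyPoly d f) :
    ∃ p : Polynomial ℚ, p.degree + 1 ≤ d ∧ ∃ n : ℕ, ∀ k : ℕ, n ≤ k → f k = p.eval (k : ℚ) := by
  suffices hlt : ∃ p : Polynomial ℚ, p.degree < d ∧ ∃ n : ℕ, ∀ k : ℕ, n ≤ k →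
      f k = p.eval (k : ℚ) by
    obtain ⟨p, hp, hf⟩ := hlt
    refine ⟨p, ?_, hf⟩
    rcases eq_or_ne p 0 with rfl | h0
    · simp
    · rw [Polynomial.degree_eq_natDegree h0] at hp ⊢
      exact_mod_cast Nat.succ_le_of_lt (Nat.cast_lt.mp hp)
  obtain ⟨c, n, h⟩ := h
  refine ⟨∑ j ∈ Finset.range d, Polynomial.C (c j / (j.factorial : ℚ)) * descPochhammer ℚ j,
    ?_, n, fun k hk => ?_⟩
  · refine (Polynomial.degree_sum_le _ _).trans_lt ?_
    refine (Finset.sup_lt_iff (WithBot.bot_lt_coe d)).mpr fun j hj => ?_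
    refine (Polynomial.degree_le_natDegree.trans
      (Nat.cast_le.mpr (Polynomial.natDegree_C_mul_le _ _))).trans_lt ?_
    rw [descPochhammer_natDegree]
    exact Nat.cast_lt.mpr (Finset.mem_range.mp hj)
  · rw [h k hk, Polynomial.eval_finsetSum]
    refine Finset.sum_congr rfl fun j _ => ?_
    rw [Polynomial.eval_mul, Polynomial.eval_C, descPochhammer_eval_eq_descFactorial,
      Nat.descFactorial_eq_factorial_mul_choose]
    have := Nat.cast_ne_zero (R := ℚ).mpr j.factorial_ne_zero
    push_cast
    field_simp

end EventuallyPoly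

/-! ### Graded subspaces and Hilbert functions -/

section Graded

open MvPolynomial

variable {F : Type*} [Field F] {σ : Type*} {L : Type*} [AddCommGroup L] [Module F L]
  [Module (MvPolynomial σ F) L]

/-- A sequence of subspaces `N k` of a module over `F[σ]`, thought of as the homogeneous parts of a
graded submodule: the variables send `N k` to `N (k + 1)`. The `N k` need not be independent. -/
def IsGradedSeq (N : ℕ → Submodule F L) : Prop :=
  ∀ (e : σ) (k : ℕ), ∀ z ∈ N k, (X e : MvPolynomial σ F) • z ∈ N (k + 1)

/-- Multiplication by `a`, regarded as an element of degree one, is zero on `N' / N`. -/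
def Kills (a : MvPolynomial σ F) (N' N : ℕ → Submodule F L) : Prop :=
  ∀ k, ∀ z ∈ N' k, a • z ∈ N (k + 1)

/-- The Hilbert function of the quotient `N' / N`. -/
noncomputable def hilb (N N' : ℕ → Submodule F L) (k : ℕ) : ℚ :=
  (Module.finrank F (N' k) : ℚ) - Module.finrank F (N k)

variable {N N' P : ℕ → Submodule F L} {a b : MvPolynomial σ F}

theorem IsGradedSeq.sub_smul_mem (hN : IsGradedSeq (σ := σ) N) (e e' : σ) {k : ℕ} {z : L}
    (hz : z ∈ N k) : (X e - X e' : MvPolynomial σ F) • z ∈ N (k + 1) := by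
  rw [sub_smul]
  exact sub_mem (hN e k z hz) (hN e' k z hz)

theorem IsGradedSeq.prod_sub_smul_mem (hN : IsGradedSeq (σ := σ) N) {m : ℕ} (a b : Fin m → σ)
    {k : ℕ} {z : L} (hz : z ∈ N k) :
    (∏ j, (X (a j) - X (b j)) : MvPolynomial σ F) • z ∈ N (k + m) := by
  induction m with
  | zero => simpa using hz
  | succ m ih =>
    rw [Fin.prod_univ_succ, mul_smul, ← add_assoc]
    exact hN.sub_smul_mem _ _ (ih (fun j => a j.succ) fun j => b j.succ)

theorem Kills.anti (h : Kills b N' N) {M : ℕ → Submodule F L} (hM : M ≤ N') : Kills b M N :=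
  fun k z hz => h k z (hM k hz)

variable [IsScalarTower F (MvPolynomial σ F) L]

/-- The graded sequence `a N' + N`, where `a` counts as an element of degree one. -/
noncomputable def smulSup (a : MvPolynomial σ F) (N' N : ℕ → Submodule F L) : ℕ → Submodule F L
  | 0 => N 0
  | k + 1 => (N' k).map (Algebra.lsmul F F L a) ⊔ N (k + 1)

/-- The graded sequence `{z ∈ N' | a z ∈ N}`, where `a` counts as an element of degree one. -/
noncomputable def colonInf (a : MvPolynomial σ F) (N' N : ℕ → Submodule F L) (k : ℕ) :
    Submodule F L :=
  N' k ⊓ (N (k + 1)).comap (Algebra.lsmul F F L a)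

variable (σ) in
/-- A graded Noetherian condition: each graded sequence inside `P` is generated in bounded
weights. -/
def BoundedlyGenerated (P : ℕ → Submodule F L) : Prop :=
  ∀ N : ℕ → Submodule F L, N ≤ P → IsGradedSeq (σ := σ) N →
    ∃ K, ∀ k, K ≤ k →
      N (k + 1) ≤ ⨆ e : σ, (N k).map (Algebra.lsmul F F L (X e : MvPolynomial σ F))

theorem le_smulSup : N ≤ smulSup a N' N := by
  rintro (_ | k)
  · exact le_rfl
  · exact le_sup_right

theorem smulSup_le (h : N ≤ N') (ha : Kills a N' N') : smulSup a N' N ≤ N' := by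
  rintro (_ | k)
  · exact h 0
  · refine sup_le ?_ (h _)
    rintro _ ⟨z, hz, rfl⟩
    exact ha k z hz

theorem colonInf_le : colonInf a N' N ≤ N' := fun k => (inf_le_left : colonInf a N' N k ≤ N' k)

theorem le_colonInf (h : N ≤ N') (ha : Kills a N N) : N ≤ colonInf a N' N := fun k =>
  le_inf (h k) fun z hz => ha k z hz

theorem IsGradedSeq.smulSup (hN : IsGradedSeq (σ := σ) N) (hN' : IsGradedSeq (σ := σ) N') :
    IsGradedSeq (σ := σ) (smulSup a N' N) := by
  rintro e (_ | k) z hz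
  · exact Submodule.mem_sup_right (hN e 0 z hz)
  · obtain ⟨_, ⟨y, hy, rfl⟩, n, hn, rfl⟩ := Submodule.mem_sup.mp hz
    rw [smul_add]
    refine add_mem (Submodule.mem_sup_left ⟨_, hN' e k y hy, ?_⟩)
      (Submodule.mem_sup_right (hN e _ n hn))
    exact smul_comm _ _ _

theorem IsGradedSeq.colonInf (hN : IsGradedSeq (σ := σ) N) (hN' : IsGradedSeq (σ := σ) N') :
    IsGradedSeq (σ := σ) (colonInf a N' N) := by
  intro e k z hz
  refine ⟨hN' e k z hz.1, ?_⟩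
  change a • (X e : MvPolynomial σ F) • z ∈ N (k + 1 + 1)
  rw [smul_comm]
  exact hN e _ _ hz.2

theorem Kills.smulSup_right (h : Kills b N' N) : Kills b N' (smulSup a N' N) := fun k z hz =>
  le_smulSup (k + 1) (h k z hz)

theorem kills_smulSup : Kills a N' (smulSup a N' N) := fun _ z hz =>
  Submodule.mem_sup_left ⟨z, hz, rfl⟩

theorem kills_colonInf : Kills a (colonInf a N' N) N := fun _ _ hz => hz.2

theorem finrank_map_add_finrank_inf_ker {L' : Type*} [AddCommGroup L'] [Module F L']
    (f : L →ₗ[F] L') (U : Submodule F L) [FiniteDimensional F U] :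
    Module.finrank F (U.map f) + Module.finrank F (U ⊓ LinearMap.ker f : Submodule F L) =
      Module.finrank F U := by
  rw [← LinearMap.finrank_range_add_finrank_ker (f.domRestrict U), LinearMap.range_domRestrict]
  congr 1
  rw [LinearMap.ker_domRestrict, ← Submodule.map_comap_subtype,
    Submodule.finrank_map_subtype_eq]

/-- The dimension count behind the exact sequence `0 → (V : f) ∩ U → U → (f U + V) / V → 0`. -/
theorem finrank_add_finrank_eq {L' : Type*} [AddCommGroup L'] [Module F L'] (f : L →ₗ[F] L')
    (U : Submodule F L) (V : Submodule F L') [FiniteDimensional F U] [FiniteDimensional F V] :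
    Module.finrank F U + Module.finrank F V =
      Module.finrank F (U ⊓ V.comap f : Submodule F L) +
        Module.finrank F (U.map f ⊔ V : Submodule F L') := by
  have h1 := finrank_map_add_finrank_inf_ker f U
  have hfd : FiniteDimensional F (U ⊓ V.comap f : Submodule F L) :=
    Submodule.finiteDimensional_inf_left _ _
  have h2 := finrank_map_add_finrank_inf_ker f (U ⊓ V.comap f)
  have h3 := Submodule.finrank_sup_add_finrank_inf_eq (U.map f) V
  have h4 : U ⊓ V.comap f ⊓ LinearMap.ker f = U ⊓ LinearMap.ker f := by
    rw [inf_assoc]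
    congr 1
    refine inf_eq_right.mpr fun z hz => ?_
    rw [Submodule.mem_comap, LinearMap.mem_ker.mp hz]
    exact zero_mem _
  have h5 : (U ⊓ V.comap f).map f = U.map f ⊓ V := by
    ext y
    constructor
    · rintro ⟨z, hz, rfl⟩
      exact ⟨⟨z, hz.1, rfl⟩, hz.2⟩
    · rintro ⟨⟨z, hz, rfl⟩, hy⟩
      exact ⟨z, ⟨hz, hy⟩, rfl⟩
  rw [h5, h4] at h2
  omega

theorem hilb_add_hilb (N N' N'' : ℕ → Submodule F L) : hilb N N'' + hilb N'' N' = hilb N N' := by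
  funext k
  simp only [hilb, Pi.add_apply]
  ring

theorem hilb_succ_sub (hfin : ∀ k, FiniteDimensional F (N' k))
    (hfin' : ∀ k, FiniteDimensional F (N k)) (k : ℕ) :
    hilb N N' (k + 1) - hilb N N' k =
      hilb (smulSup a N' N) N' (k + 1) - hilb N (colonInf a N' N) k := by
  have h := finrank_add_finrank_eq (Algebra.lsmul F F L a) (N' k) (N (k + 1))
  have h' : (Module.finrank F (N' k) : ℚ) + Module.finrank F (N (k + 1)) =
      Module.finrank F (colonInf a N' N k) + Module.finrank F (smulSup a N' N (k + 1)) := by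
    exact_mod_cast h
  simp only [hilb]
  linarith

theorem hilb_eventuallyPoly_of_le {d n : ℕ} (h : N ≤ N') (h' : ∀ k, n ≤ k → N' k ≤ N k) :
    EventuallyPoly d (hilb N N') :=
  .of_eventually_zero n fun k hk => by rw [hilb, le_antisymm (h' k hk) (h k), sub_self]

/-- A Hilbert–Serre theorem: if, on `N' / N`, every variable acts as zero or as one of the
variables in `Y`, then the Hilbert function of `N' / N` is eventually polynomial of degree less
than `|Y|`. A variable `y ∈ Y` is eliminated with the help of the kernel and the cokernel of
multiplication by `y`. -/
theorem eventuallyPoly_hilb (hP : BoundedlyGenerated σ P)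
    (hfin : ∀ k, FiniteDimensional F (P k)) (Y : Finset σ) (hN : IsGradedSeq (σ := σ) N)
    (hN' : IsGradedSeq (σ := σ) N') (hle : N ≤ N') (hle' : N' ≤ P)
    (hY : ∀ e : σ, Kills (X e : MvPolynomial σ F) N' N ∨
      ∃ y ∈ Y, Kills (X e - X y : MvPolynomial σ F) N' N) :
    EventuallyPoly Y.card (hilb N N') := by
  classical
  induction Y using Finset.induction_on generalizing N N' with
  | empty =>
    obtain ⟨K, hK⟩ := hP N' hle' hN'
    refine hilb_eventuallyPoly_of_le (n := K + 1) hle fun k hk => ?_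
    obtain ⟨k, rfl⟩ : ∃ j, k = j + 1 := ⟨k - 1, by omega⟩
    refine (hK k (by omega)).trans (iSup_le fun e => ?_)
    rintro _ ⟨z, hz, rfl⟩
    exact ((hY e).resolve_right (by simp)) k z hz
  | insert y Y hy ih =>
    -- Once `y` itself acts as zero, so does every variable that acts as `y`.
    have key : ∀ {M M' : ℕ → Submodule F L}, Kills (X y : MvPolynomial σ F) M' M →
        (∀ b : MvPolynomial σ F, Kills b N' N → Kills b M' M) →
        ∀ e : σ, Kills (X e : MvPolynomial σ F) M' M ∨
          ∃ y ∈ Y, Kills (X e - X y : MvPolynomial σ F) M' M := by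
      intro M M' hM hb e
      rcases hY e with h | ⟨x, hx, h⟩
      · exact .inl (hb _ h)
      · rcases Finset.mem_insert.mp hx with rfl | hx
        · refine .inl fun k z hz => ?_
          have := add_mem (hb _ h k z hz) (hM k z hz)
          rwa [← add_smul, sub_add_cancel] at this
        · exact .inr ⟨x, hx, hb _ h⟩
    have h1 := ih (N := smulSup (X y) N' N) (N' := N') (hN.smulSup hN') hN'
      (smulSup_le hle (hN' y)) hle' (key kills_smulSup fun b hb => hb.smulSup_right)
    have h2 := ih (N := N) (N' := colonInf (X y) N' N) hN (hN.colonInf hN')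
      (le_colonInf hle (hN y)) (colonInf_le.trans hle')
      (key kills_colonInf fun b hb => hb.anti colonInf_le)
    rw [Finset.card_insert_of_notMem hy]
    refine .of_diff ?_
    have hf' : ∀ k, FiniteDimensional F (N' k) := fun k =>
      Submodule.finiteDimensional_of_le (hle' k)
    have hf : ∀ k, FiniteDimensional F (N k) := fun k =>
      Submodule.finiteDimensional_of_le (hle k)
    have h3 := h1.shift.add h2.neg
    convert h3 using 1
    funext k
    rw [hilb_succ_sub (a := (X y : MvPolynomial σ F)) hf' hf]
    simp [sub_eq_add_neg]

/-- Dévissage. The linear forms `X (a t) - X (b t)` carry labels `ℓ t`, and the products of `m`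
forms with distinct labels outside `T` are zero on `N' / N`. If the conclusion holds for every
quotient on which all forms with label outside some set of at most `i` labels are zero, then it
holds for `N' / N`: for a form `α`, filter `N' / N` by the image of `α`. On the cokernel `α` is
zero; on the image, products of `m - 1` forms with labels different from that of `α` are zero. -/
theorem eventuallyPoly_hilb_of_prod {τ V : Type*} (a b : τ → σ) (ℓ : τ → V) (i d : ℕ)
    (hbase : ∀ (T : Finset V) (N N' : ℕ → Submodule F L), T.card ≤ i → ↑T ⊆ Set.range ℓ →
      IsGradedSeq (σ := σ) N → IsGradedSeq (σ := σ) N' → N ≤ N' → N' ≤ P →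
      (∀ t, ℓ t ∉ T → Kills (X (a t) - X (b t) : MvPolynomial σ F) N' N) →
      EventuallyPoly d (hilb N N'))
    (l : List τ) (m : ℕ) (T : Finset V) (hm : T.card + m = i + 1) (hT : ↑T ⊆ Set.range ℓ)
    (hN : IsGradedSeq (σ := σ) N) (hN' : IsGradedSeq (σ := σ) N') (hle : N ≤ N') (hle' : N' ≤ P)
    (hl : ∀ t, ℓ t ∉ T → t ∈ l ∨ Kills (X (a t) - X (b t) : MvPolynomial σ F) N' N)
    (hprod : ∀ s : Fin m → τ, Function.Injective (ℓ ∘ s) → (∀ j, ℓ (s j) ∉ T) →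
      ∀ k, ∀ z ∈ N' k, (∏ j, (X (a (s j)) - X (b (s j)) : MvPolynomial σ F)) • z ∈ N (k + m)) :
    EventuallyPoly d (hilb N N') := by
  classical
  induction l generalizing m T N N' with
  | nil =>
    cases m with
    | zero =>
      refine hilb_eventuallyPoly_of_le (n := 0) hle fun k _ z hz => ?_
      simpa using hprod Fin.elim0 (fun j => j.elim0) (fun j => j.elim0) k z hz
    | succ m =>
      exact hbase T N N' (by omega) hT hN hN' hle hle' fun t ht =>
        (hl t ht).resolve_left List.not_mem_nil
  | cons t l ih =>
    cases m with
    | zero =>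
      refine hilb_eventuallyPoly_of_le (n := 0) hle fun k _ z hz => ?_
      simpa using hprod Fin.elim0 (fun j => j.elim0) (fun j => j.elim0) k z hz
    | succ m =>
      by_cases htT : ℓ t ∈ T
      · refine ih (m + 1) T hm hT hN hN' hle hle' (fun s hs => ?_) hprod
        refine (hl s hs).imp_left fun h => ?_
        exact (List.mem_cons.mp h).resolve_left fun h => hs (h ▸ htT)
      have hM := hN.smulSup hN' (a := X (a t) - X (b t))
      have hle₂ : smulSup (X (a t) - X (b t)) N' N ≤ N' :=
        smulSup_le hle fun k z hz => hN'.sub_smul_mem _ _ hz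
      rw [← hilb_add_hilb N N' (smulSup (X (a t) - X (b t)) N' N)]
      refine .add ?_ ?_
      · refine ih m (insert (ℓ t) T) (by rw [Finset.card_insert_of_notMem htT]; omega) ?_ hN hM
          le_smulSup (hle₂.trans hle') ?_ ?_
        · rw [Finset.coe_insert]
          exact Set.insert_subset ⟨t, rfl⟩ hT
        · intro s hs
          rw [Finset.mem_insert, not_or] at hs
          rcases hl s hs.2 with h | h
          · exact .inl ((List.mem_cons.mp h).resolve_left fun h => hs.1 (h ▸ rfl))
          · exact .inr (h.anti hle₂)
        · intro s hs hsT k z hz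
          have hsT' : ∀ j, ℓ (s j) ≠ ℓ t ∧ ℓ (s j) ∉ T := fun j => by
            simpa [Finset.mem_insert, not_or] using hsT j
          cases k with
          | zero => exact hN.prod_sub_smul_mem _ _ hz
          | succ k =>
            obtain ⟨_, ⟨y, hy, rfl⟩, n, hn, rfl⟩ := Submodule.mem_sup.mp hz
            rw [smul_add]
            refine add_mem ?_ (hN.prod_sub_smul_mem _ _ hn)
            have := hprod (Fin.cons t s) ?_ ?_ k y hy
            · rw [Fin.prod_univ_succ, mul_comm, mul_smul] at this
              simp only [Fin.cons_zero, Fin.cons_succ] at this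
              rw [show k + 1 + m = k + (m + 1) by omega]
              exact this
            · have : ℓ ∘ Fin.cons t s = (Fin.cons (ℓ t) (ℓ ∘ s) : Fin (m + 1) → V) := by
                funext j
                cases j using Fin.cases <;> rfl
              rw [this, Fin.cons_injective_iff]
              exact ⟨fun ⟨j, hj⟩ => (hsT' j).1 hj, hs⟩
            · intro j
              cases j using Fin.cases with
              | zero => exact htT
              | succ j => exact (hsT' j).2
      · refine ih (m + 1) T hm hT hM hN' hle₂ hle' ?_ fun s hs hsT k z hz =>
          le_smulSup _ (hprod s hs hsT k z hz)
        intro s hs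
        rcases hl s hs with h | h
        · rcases List.mem_cons.mp h with rfl | h
          · exact .inr kills_smulSup
          · exact .inl h
        · exact .inr h.smulSup_right

end Graded

/-! ### Noetherianity -/

section Noetherian

open MvPolynomial

theorem homogeneousComponent_succ_X_mul {σ R : Type*} [CommSemiring R] (e : σ) (n : ℕ)
    (q : MvPolynomial σ R) :
    homogeneousComponent (n + 1) (X e * q) = X e * homogeneousComponent n q := by
  classical
  ext m
  rw [coeff_homogeneousComponent, coeff_X_mul', coeff_X_mul', coeff_homogeneousComponent]
  by_cases hm : e ∈ m.support
  · have : m.degree = (m - Finsupp.single e 1).degree + 1 := by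
      have hle : Finsupp.single e 1 ≤ m :=
        Finsupp.single_le_iff.mpr (Nat.one_le_iff_ne_zero.mpr (Finsupp.mem_support_iff.mp hm))
      conv_lhs => rw [← tsub_add_cancel_of_le hle, map_add, Finsupp.degree_single]
    simp only [if_pos hm, this, Nat.add_right_cancel_iff]
  · simp only [if_neg hm, ite_self]

theorem homogeneousComponent_zero_X_mul {σ R : Type*} [CommSemiring R] (e : σ)
    (q : MvPolynomial σ R) : homogeneousComponent 0 (X e * q) = 0 := by
  classical
  rw [homogeneousComponent_zero, coeff_X_mul']
  simp

variable {F : Type*} [Field F] {σ : Type*} {L : Type*} [AddCommGroup L] [Module F L]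
  [Module (MvPolynomial σ F) L] [IsScalarTower F (MvPolynomial σ F) L]

/-- The subspaces that agree with `N` up to weight `K` and are generated by `N K` beyond it. -/
noncomputable def truncGen (N : ℕ → Submodule F L) (K : ℕ) : ℕ → Submodule F L
  | 0 => N 0
  | n + 1 => if n + 1 ≤ K then N (n + 1) else
      ⨆ e : σ, (truncGen N K n).map (Algebra.lsmul F F L (X e : MvPolynomial σ F))

variable {N : ℕ → Submodule F L}

theorem truncGen_of_le {K n : ℕ} (h : n ≤ K) : truncGen (σ := σ) N K n = N n := by
  cases n with
  | zero => rfl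
  | succ n => rw [truncGen, if_pos h]

theorem truncGen_le (hN : IsGradedSeq (σ := σ) N) (K n : ℕ) : truncGen (σ := σ) N K n ≤ N n := by
  induction n with
  | zero => exact le_rfl
  | succ n ih =>
    rw [truncGen]
    split_ifs
    · exact le_rfl
    · refine iSup_le fun e => ?_
      rintro _ ⟨z, hz, rfl⟩
      exact hN e n z (ih hz)

theorem isGradedSeq_truncGen (hN : IsGradedSeq (σ := σ) N) (K : ℕ) :
    IsGradedSeq (σ := σ) (truncGen (σ := σ) N K) := by
  intro e n z hz
  rw [truncGen]
  split_ifs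
  · exact hN e n z (truncGen_le hN K n hz)
  · exact Submodule.mem_iSup_of_mem e ⟨z, hz, rfl⟩

theorem truncGen_mono (hN : IsGradedSeq (σ := σ) N) {K K' : ℕ} (hK : K ≤ K') (n : ℕ) :
    truncGen (σ := σ) N K n ≤ truncGen (σ := σ) N K' n := by
  induction n with
  | zero => exact le_rfl
  | succ n ih =>
    by_cases h : n + 1 ≤ K'
    · rw [truncGen_of_le h]
      exact truncGen_le hN K _
    · rw [truncGen, truncGen, if_neg h, if_neg (by omega)]
      exact iSup_mono fun e => Submodule.map_mono ih

variable {G : Type*} [Fintype G] (g : G → L) (i : ℕ)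

/-- The elements of the free module on `G` whose homogeneous components all map into `N` under
the map determined by `g`, the generators having weight `i`. -/
noncomputable def gradedPreimage (N : ℕ → Submodule F L) (hN : IsGradedSeq (σ := σ) N) :
    Submodule (MvPolynomial σ F) (G → MvPolynomial σ F) where
  carrier := {w | ∀ n, ∑ j, homogeneousComponent n (w j) • g j ∈ N (n + i)}
  add_mem' {w w'} hw hw' n := by
    simp only [Pi.add_apply, map_add, add_smul, Finset.sum_add_distrib]
    exact add_mem (hw n) (hw' n)
  zero_mem' n := by simp
  smul_mem' p w hw := by
    induction p using MvPolynomial.induction_on generalizing w with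
    | C a =>
      intro n
      convert (N (n + i)).smul_mem a (hw n) using 1
      rw [Finset.smul_sum]
      refine Finset.sum_congr rfl fun j _ => ?_
      rw [Pi.smul_apply, smul_eq_mul, homogeneousComponent_C_mul, ← smul_eq_C_mul, smul_assoc]
    | add p q hp hq =>
      intro n
      have := add_mem (hp w hw n) (hq w hw n)
      rw [← Finset.sum_add_distrib] at this
      convert this using 2 with j
      simp only [Pi.smul_apply, smul_eq_mul, add_mul, map_add, add_smul]
    | mul_X p e hp =>
      rw [mul_smul]
      refine hp _ ?_
      rintro (_ | n)
      · simp only [Pi.smul_apply, smul_eq_mul, homogeneousComponent_zero_X_mul, zero_smul,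
          Finset.sum_const_zero, zero_mem]
      · rw [add_right_comm]
        convert hN e _ _ (hw n) using 1
        rw [Finset.smul_sum]
        refine Finset.sum_congr rfl fun j _ => ?_
        rw [Pi.smul_apply, smul_eq_mul, homogeneousComponent_succ_X_mul, mul_smul]

variable (F σ) in
/-- The part of weight `k` of the module generated by the `g j` in weight `i`. -/
noncomputable def homogeneousSpan (k : ℕ) : Submodule F L :=
  Submodule.span F {z | ∃ (q : MvPolynomial σ F) (b : ℕ) (j : G), q.IsHomogeneous b ∧ b + i = k ∧
    z = q • g j}

theorem exists_of_mem_homogeneousSpan {k : ℕ} {z : L} (hz : z ∈ homogeneousSpan F σ g i k) :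
    ∃ w : G → MvPolynomial σ F,
      (∀ j, (w j).IsHomogeneous (k - i)) ∧ z = ∑ j, w j • g j := by
  classical
  induction hz using Submodule.span_induction with
  | mem z hz =>
    obtain ⟨q, b, j, hq, rfl, rfl⟩ := hz
    refine ⟨Pi.single j q, fun j' => ?_, ?_⟩
    · rcases eq_or_ne j' j with rfl | h
      · rwa [Pi.single_eq_same, Nat.add_sub_cancel]
      · rw [Pi.single_eq_of_ne h]
        exact isHomogeneous_zero _ _ _
    · rw [Finset.sum_eq_single j (fun j' _ h => by rw [Pi.single_eq_of_ne h, zero_smul])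
        (by simp), Pi.single_eq_same]
  | zero => exact ⟨0, fun _ => isHomogeneous_zero _ _ _, by simp⟩
  | add z z' _ _ h h' =>
    obtain ⟨w, hw, rfl⟩ := h
    obtain ⟨w', hw', rfl⟩ := h'
    exact ⟨w + w', fun j => (hw j).add (hw' j), by
      simp only [Pi.add_apply, add_smul, Finset.sum_add_distrib]⟩
  | smul a z _ h =>
    obtain ⟨w, hw, rfl⟩ := h
    exact ⟨a • w, fun j => (homogeneousSubmodule σ F _).smul_mem a (hw j), by
      simp only [Pi.smul_apply, Finset.smul_sum, smul_assoc]⟩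

variable [Finite σ]

theorem finiteDimensional_homogeneousSpan (k : ℕ) :
    FiniteDimensional F (homogeneousSpan F σ g i k) := by
  have hfd : FiniteDimensional F (homogeneousSubmodule σ F (k - i)) :=
    Module.Finite.iff_fg.mpr (homogeneousSubmodule_fg _ _ _)
  let f : (G → homogeneousSubmodule σ F (k - i)) →ₗ[F] L :=
    ∑ j, ((LinearMap.toSpanSingleton (MvPolynomial σ F) L (g j)).restrictScalars F ∘ₗ
      (homogeneousSubmodule σ F (k - i)).subtype) ∘ₗ LinearMap.proj j
  refine Submodule.finiteDimensional_of_le (S₂ := LinearMap.range f) fun z hz => ?_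
  obtain ⟨w, hw, rfl⟩ := exists_of_mem_homogeneousSpan g i hz
  exact ⟨fun j => ⟨w j, hw j⟩, by simp [f]⟩

/-- Graded sequences embed into the submodules of a free module of finite rank, so that the
sequences `truncGen N K`, which increase with `K`, become stationary. -/
theorem boundedlyGenerated_homogeneousSpan :
    BoundedlyGenerated σ (homogeneousSpan F σ g i) := by
  intro N hNP hN
  let c : ℕ →o Submodule (MvPolynomial σ F) (G → MvPolynomial σ F) :=
    ⟨fun K => gradedPreimage g i (truncGen (σ := σ) N K) (isGradedSeq_truncGen hN K),
      fun K K' hK w hw n => truncGen_mono hN hK _ (hw n)⟩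
  obtain ⟨K, hK⟩ := monotone_stabilizes_iff_noetherian.mpr
    (inferInstance : IsNoetherian (MvPolynomial σ F) (G → MvPolynomial σ F)) c
  refine ⟨K + i, fun k hk z hz => ?_⟩
  obtain ⟨w, hw, rfl⟩ := exists_of_mem_homogeneousSpan g i (hNP _ hz)
  have hcomp : ∀ j n, homogeneousComponent n (w j) = if n = k + 1 - i then w j else 0 :=
    fun j n => homogeneousComponent_of_mem (hw j)
  have hmem : w ∈ c (k + 1) := by
    intro n
    simp only [hcomp]
    split_ifs with hn
    · subst hn
      rw [Nat.sub_add_cancel (by omega), truncGen_of_le le_rfl]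
      exact hz
    · simp
  rw [← hK (k + 1) (by omega), hK k (by omega)] at hmem
  have := hmem (k + 1 - i)
  simp only [hcomp, if_true] at this
  rw [Nat.sub_add_cancel (by omega), truncGen, if_neg (by omega), truncGen_of_le le_rfl] at this
  exact this

end Noetherian

namespace FinGraph

/-! ### Chain maps homotopic to multiplication by a difference of edges -/

section Homotopy

variable (Γ : FinGraph.{u}) (R : Type v) [CommRing R]

/-- The difference `h - h'` of half-edges. -/
noncomputable def halfEdgeSub (h h' : Γ.H) : Γ.H →₀ Γ.EdgeRing R :=
  Finsupp.single h 1 - Finsupp.single h' 1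

open Classical in
/-- The projection of the exterior algebra that sends the half-edges at `x` to zero. -/
noncomputable def killAt (x : Γ.V) : Γ.HalfEdgeAlgebra R →ₐ[Γ.EdgeRing R] Γ.HalfEdgeAlgebra R :=
  ExteriorAlgebra.map (Finsupp.linearCombination (Γ.EdgeRing R) fun h =>
    if Γ.vert h = x then (0 : Γ.H →₀ Γ.EdgeRing R) else Finsupp.single h 1)

/-- The homotopy `y ↦ (h - h') π(y)`, where `π` is the projection to the states that are empty at
the vertex of `h`. -/
noncomputable def insertSub (h h' : Γ.H) :
    Γ.HalfEdgeAlgebra R →ₗ[Γ.EdgeRing R] Γ.HalfEdgeAlgebra R :=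
  LinearMap.mulLeft (Γ.EdgeRing R) (ExteriorAlgebra.ι (Γ.EdgeRing R) (Γ.halfEdgeSub R h h')) ∘ₗ
    (Γ.killAt R (Γ.vert h)).toLinearMap

/-- The chain map that `insertSub` connects to multiplication by `e(h) - e(h')`. -/
noncomputable def edgeSubMap (h h' : Γ.H) :
    Γ.HalfEdgeAlgebra R →ₗ[Γ.EdgeRing R] Γ.HalfEdgeAlgebra R :=
  (MvPolynomial.X (Γ.edge h) - MvPolynomial.X (Γ.edge h') : Γ.EdgeRing R) • LinearMap.id -
    Γ.halfEdgeDiff R ∘ₗ Γ.insertSub R h h' - Γ.insertSub R h h' ∘ₗ Γ.halfEdgeDiff R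

variable {Γ}

theorem edgeForm_halfEdgeSub (h h' : Γ.H) : Γ.edgeForm R (Γ.halfEdgeSub R h h') =
    MvPolynomial.X (Γ.edge h) - MvPolynomial.X (Γ.edge h') := by
  simp [edgeForm, halfEdgeSub]

theorem halfEdgeDiff_ι_mul (u : Γ.H →₀ Γ.EdgeRing R) (y : Γ.HalfEdgeAlgebra R) :
    Γ.halfEdgeDiff R (ExteriorAlgebra.ι (Γ.EdgeRing R) u * y) =
      Γ.edgeForm R u • y - ExteriorAlgebra.ι (Γ.EdgeRing R) u * Γ.halfEdgeDiff R y :=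
  CliffordAlgebra.contractLeft_ι_mul _ _ _

theorem halfEdgeDiff_one : Γ.halfEdgeDiff R 1 = 0 := CliffordAlgebra.contractLeft_one _ _

theorem state_zero (f g : Fin 0 → Γ.H) : Γ.state R f g = 1 :=
  ExteriorAlgebra.ιMulti_zero_apply _

theorem state_succ {i : ℕ} (f g : Fin (i + 1) → Γ.H) : Γ.state R f g =
    ExteriorAlgebra.ι (Γ.EdgeRing R) (Γ.halfEdgeSub R (f 0) (g 0)) *
      Γ.state R (f ∘ Fin.succ) (g ∘ Fin.succ) := by
  simp only [state]
  rw [ExteriorAlgebra.ιMulti_succ_apply]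
  rfl

theorem state_cons {i : ℕ} (h h' : Γ.H) (f g : Fin i → Γ.H) :
    Γ.state R (Fin.cons h f : Fin (i + 1) → Γ.H) (Fin.cons h' g : Fin (i + 1) → Γ.H) =
      ExteriorAlgebra.ι (Γ.EdgeRing R) (Γ.halfEdgeSub R h h') * Γ.state R f g :=
  state_succ R _ _

theorem killAt_ι_of_ne {x : Γ.V} {h h' : Γ.H} (hx : Γ.vert h ≠ x) (hx' : Γ.vert h' ≠ x) :
    Γ.killAt R x (ExteriorAlgebra.ι (Γ.EdgeRing R) (Γ.halfEdgeSub R h h')) =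
      ExteriorAlgebra.ι (Γ.EdgeRing R) (Γ.halfEdgeSub R h h') := by
  rw [killAt, ExteriorAlgebra.map_apply_ι]
  simp [halfEdgeSub, hx, hx']

theorem killAt_ι_of_eq {x : Γ.V} {h h' : Γ.H} (hx : Γ.vert h = x) (hx' : Γ.vert h' = x) :
    Γ.killAt R x (ExteriorAlgebra.ι (Γ.EdgeRing R) (Γ.halfEdgeSub R h h')) = 0 := by
  rw [killAt, ExteriorAlgebra.map_apply_ι]
  simp [halfEdgeSub, hx, hx']

theorem killAt_state_of_ne {i : ℕ} {x : Γ.V} {f g : Fin i → Γ.H} (hf : ∀ j, Γ.vert (f j) ≠ x)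
    (hg : ∀ j, Γ.vert (g j) ≠ x) : Γ.killAt R x (Γ.state R f g) = Γ.state R f g := by
  induction i with
  | zero => rw [state_zero, map_one]
  | succ i ih =>
    rw [state_succ, map_mul, killAt_ι_of_ne R (hf 0) (hg 0),
      ih (f := f ∘ Fin.succ) (g := g ∘ Fin.succ) (fun j => hf j.succ) fun j => hg j.succ]

theorem killAt_state_of_eq {i : ℕ} {x : Γ.V} {f g : Fin i → Γ.H} (j : Fin i)
    (hf : Γ.vert (f j) = x) (hg : Γ.vert (g j) = x) : Γ.killAt R x (Γ.state R f g) = 0 := by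
  induction i with
  | zero => exact j.elim0
  | succ i ih =>
    rw [state_succ, map_mul]
    cases j using Fin.cases with
    | zero => rw [killAt_ι_of_eq R hf hg, zero_mul]
    | succ j => rw [ih (f := f ∘ Fin.succ) (g := g ∘ Fin.succ) j hf hg, mul_zero]

theorem insertSub_apply (h h' : Γ.H) (y : Γ.HalfEdgeAlgebra R) : Γ.insertSub R h h' y =
    ExteriorAlgebra.ι (Γ.EdgeRing R) (Γ.halfEdgeSub R h h') * Γ.killAt R (Γ.vert h) y := rfl

theorem edgeSubMap_apply (h h' : Γ.H) (y : Γ.HalfEdgeAlgebra R) : Γ.edgeSubMap R h h' y =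
    (MvPolynomial.X (Γ.edge h) - MvPolynomial.X (Γ.edge h') : Γ.EdgeRing R) • y -
      Γ.halfEdgeDiff R (Γ.insertSub R h h' y) - Γ.insertSub R h h' (Γ.halfEdgeDiff R y) := rfl

theorem edgeSubMap_one (h h' : Γ.H) : Γ.edgeSubMap R h h' 1 = 0 := by
  rw [edgeSubMap_apply, halfEdgeDiff_one, map_zero, insertSub_apply, map_one, halfEdgeDiff_ι_mul,
    halfEdgeDiff_one, edgeForm_halfEdgeSub]
  simp

/-- The map `edgeSubMap` only involves the tensor factor at the vertex of `h`. -/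
theorem edgeSubMap_ι_mul_of_ne {h h' p q : Γ.H} (hp : Γ.vert p ≠ Γ.vert h)
    (hq : Γ.vert q ≠ Γ.vert h) (y : Γ.HalfEdgeAlgebra R) :
    Γ.edgeSubMap R h h' (ExteriorAlgebra.ι (Γ.EdgeRing R) (Γ.halfEdgeSub R p q) * y) =
      ExteriorAlgebra.ι (Γ.EdgeRing R) (Γ.halfEdgeSub R p q) * Γ.edgeSubMap R h h' y := by
  have hins : ∀ z, Γ.insertSub R h h'
      (ExteriorAlgebra.ι (Γ.EdgeRing R) (Γ.halfEdgeSub R p q) * z) =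
        -(ExteriorAlgebra.ι (Γ.EdgeRing R) (Γ.halfEdgeSub R p q) * Γ.insertSub R h h' z) := by
    intro z
    rw [insertSub_apply, insertSub_apply, map_mul, killAt_ι_of_ne R hp hq, ← mul_assoc,
      ← mul_assoc, ← neg_mul, eq_neg_of_add_eq_zero_left (ExteriorAlgebra.ι_add_mul_swap _ _)]
  rw [edgeSubMap_apply, edgeSubMap_apply, hins, map_neg, halfEdgeDiff_ι_mul, halfEdgeDiff_ι_mul,
    map_sub, map_smul, hins, mul_sub, mul_sub, mul_smul_comm]
  abel

theorem edgeSubMap_ι_mul_of_eq {h h' p q : Γ.H} (hp : Γ.vert p = Γ.vert h)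
    (hq : Γ.vert q = Γ.vert h) {y : Γ.HalfEdgeAlgebra R} (hy : Γ.killAt R (Γ.vert h) y = y) :
    Γ.edgeSubMap R h h' (ExteriorAlgebra.ι (Γ.EdgeRing R) (Γ.halfEdgeSub R p q) * y) =
      (MvPolynomial.X (Γ.edge h) - MvPolynomial.X (Γ.edge h') : Γ.EdgeRing R) •
          (ExteriorAlgebra.ι (Γ.EdgeRing R) (Γ.halfEdgeSub R p q) * y) -
        (MvPolynomial.X (Γ.edge p) - MvPolynomial.X (Γ.edge q) : Γ.EdgeRing R) •
          (ExteriorAlgebra.ι (Γ.EdgeRing R) (Γ.halfEdgeSub R h h') * y) := by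
  have hins : ∀ z, Γ.insertSub R h h'
      (ExteriorAlgebra.ι (Γ.EdgeRing R) (Γ.halfEdgeSub R p q) * z) = 0 := by
    intro z
    rw [insertSub_apply, map_mul, killAt_ι_of_eq R hp hq, zero_mul, mul_zero]
  rw [edgeSubMap_apply, hins, map_zero, sub_zero, halfEdgeDiff_ι_mul, map_sub, hins, sub_zero,
    map_smul, insertSub_apply, hy, edgeForm_halfEdgeSub]

variable (Γ) in
/-- The combinations of the states at the given vertices `w j` whose coefficients are homogeneous
of degree `c`. -/
noncomputable def stateSpan {i : ℕ} (w : Fin i → Γ.V) (c : ℕ) :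
    Submodule R (Γ.HalfEdgeAlgebra R) :=
  Submodule.span R {z | ∃ (p : Γ.EdgeRing R) (f g : Fin i → Γ.H), p.IsHomogeneous c ∧
    (∀ j, Γ.vert (f j) = w j) ∧ (∀ j, Γ.vert (g j) = w j) ∧ z = p • Γ.state R f g}

theorem smul_mem_stateSpan {i : ℕ} {w : Fin i → Γ.V} {c a : ℕ} {p : Γ.EdgeRing R}
    (hp : p.IsHomogeneous a) {z : Γ.HalfEdgeAlgebra R} (hz : z ∈ Γ.stateSpan R w c) :
    p • z ∈ Γ.stateSpan R w (a + c) := by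
  induction hz using Submodule.span_induction with
  | mem z hz =>
    obtain ⟨q, f, g, hq, hf, hg, rfl⟩ := hz
    exact Submodule.subset_span ⟨p * q, f, g, hp.mul hq, hf, hg, (mul_smul _ _ _).symm⟩
  | zero => rw [smul_zero]; exact zero_mem _
  | add z z' _ _ h h' => rw [smul_add]; exact add_mem h h'
  | smul r z _ h => rw [smul_comm]; exact Submodule.smul_mem _ _ h

theorem ι_mul_mem_stateSpan {i : ℕ} {w : Fin (i + 1) → Γ.V} {c : ℕ} {p q : Γ.H}
    (hp : Γ.vert p = w 0) (hq : Γ.vert q = w 0) {z : Γ.HalfEdgeAlgebra R}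
    (hz : z ∈ Γ.stateSpan R (w ∘ Fin.succ) c) :
    ExteriorAlgebra.ι (Γ.EdgeRing R) (Γ.halfEdgeSub R p q) * z ∈ Γ.stateSpan R w c := by
  induction hz using Submodule.span_induction with
  | mem z hz =>
    obtain ⟨r, f, g, hr, hf, hg, rfl⟩ := hz
    refine Submodule.subset_span ⟨r, Fin.cons p f, Fin.cons q g, hr, ?_, ?_, ?_⟩
    · exact Fin.cases hp hf
    · exact Fin.cases hq hg
    · rw [state_cons, mul_smul_comm]
  | zero => rw [mul_zero]; exact zero_mem _
  | add z z' _ _ h h' => rw [mul_add]; exact add_mem h h'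
  | smul r z _ h => rw [mul_smul_comm]; exact Submodule.smul_mem _ _ h

theorem edgeSubMap_state {h h' : Γ.H} (hv : Γ.vert h = Γ.vert h') {i : ℕ} (w : Fin i → Γ.V)
    (hw : Function.Injective w) (f g : Fin i → Γ.H) (hf : ∀ j, Γ.vert (f j) = w j)
    (hg : ∀ j, Γ.vert (g j) = w j) :
    Γ.edgeSubMap R h h' (Γ.state R f g) ∈ Γ.stateSpan R w 1 ∧
      (Γ.vert h ∉ Set.range w → Γ.edgeSubMap R h h' (Γ.state R f g) = 0) := by
  induction i with
  | zero =>
    rw [state_zero, edgeSubMap_one]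
    exact ⟨zero_mem _, fun _ => rfl⟩
  | succ i ih =>
    have ih' := ih (w ∘ Fin.succ) (hw.comp (Fin.succ_injective _)) (f ∘ Fin.succ) (g ∘ Fin.succ)
      (fun j => hf j.succ) fun j => hg j.succ
    rw [state_succ]
    by_cases h0 : w 0 = Γ.vert h
    · refine ⟨?_, fun hr => absurd ⟨0, h0⟩ hr⟩
      have hne : ∀ j : Fin i, w j.succ ≠ Γ.vert h := fun j hj =>
        Fin.succ_ne_zero j (hw (hj.trans h0.symm))
      have hX : ∀ p q : Γ.H, (MvPolynomial.X (Γ.edge p) - MvPolynomial.X (Γ.edge q) :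
          Γ.EdgeRing R).IsHomogeneous 1 := fun p q =>
        (MvPolynomial.isHomogeneous_X R _).sub (MvPolynomial.isHomogeneous_X R _)
      rw [edgeSubMap_ι_mul_of_eq R ((hf 0).trans h0) ((hg 0).trans h0)
        (killAt_state_of_ne R (fun j => by rw [Function.comp, hf]; exact hne j)
          fun j => by rw [Function.comp, hg]; exact hne j), ← state_cons, ← state_cons]
      refine sub_mem (Submodule.subset_span ⟨_, _, _, hX _ _, ?_, ?_, rfl⟩)
        (Submodule.subset_span ⟨_, _, _, hX _ _, ?_, ?_, rfl⟩)
      · exact Fin.cases (hf 0) fun j => hf j.succ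
      · exact Fin.cases (hg 0) fun j => hg j.succ
      · exact Fin.cases h0.symm fun j => hf j.succ
      · exact Fin.cases (hv.symm.trans h0.symm) fun j => hg j.succ
    · rw [edgeSubMap_ι_mul_of_ne R (by rwa [hf 0]) (by rwa [hg 0])]
      refine ⟨ι_mul_mem_stateSpan R (hf 0) (hg 0) ih'.1, fun hr => ?_⟩
      rw [ih'.2 fun ⟨j, hj⟩ => hr ⟨j.succ, hj⟩, mul_zero]

theorem edgeSubMap_mem_stateSpan {h h' : Γ.H} (hv : Γ.vert h = Γ.vert h') {i c : ℕ}
    {w : Fin i → Γ.V} (hw : Function.Injective w) {z : Γ.HalfEdgeAlgebra R}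
    (hz : z ∈ Γ.stateSpan R w c) : Γ.edgeSubMap R h h' z ∈ Γ.stateSpan R w (c + 1) := by
  induction hz using Submodule.span_induction with
  | mem z hz =>
    obtain ⟨p, f, g, hp, hf, hg, rfl⟩ := hz
    rw [map_smul]
    exact smul_mem_stateSpan R hp (edgeSubMap_state R hv w hw f g hf hg).1
  | zero => rw [map_zero]; exact zero_mem _
  | add z z' _ _ h h' => rw [map_add]; exact add_mem h h'
  | smul r z _ h => rw [LinearMap.map_smul_of_tower]; exact Submodule.smul_mem _ _ h

theorem edgeSubMap_eq_zero {h h' : Γ.H} (hv : Γ.vert h = Γ.vert h') {i c : ℕ}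
    {w : Fin i → Γ.V} (hw : Function.Injective w) (hr : Γ.vert h ∉ Set.range w)
    {z : Γ.HalfEdgeAlgebra R} (hz : z ∈ Γ.stateSpan R w c) : Γ.edgeSubMap R h h' z = 0 := by
  induction hz using Submodule.span_induction with
  | mem z hz =>
    obtain ⟨p, f, g, hp, hf, hg, rfl⟩ := hz
    rw [map_smul, (edgeSubMap_state R hv w hw f g hf hg).2 hr, smul_zero]
  | zero => rw [map_zero]
  | add z z' _ _ h h' => rw [map_add, h, h', add_zero]
  | smul r z _ h => rw [LinearMap.map_smul_of_tower, h, smul_zero]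

end Homotopy

end FinGraph

namespace FinGraph

/-! ### The chain maps on the reduced complex -/

section Reduced

variable {Γ : FinGraph.{u}} (R : Type v) [CommRing R]

variable (Γ) in
/-- A pair of half-edges at one vertex. -/
abbrev HalfEdgePair : Type u := {t : Γ.H × Γ.H // Γ.vert t.1 = Γ.vert t.2}

/-- The vertex of a pair of half-edges. -/
abbrev HalfEdgePair.base (t : Γ.HalfEdgePair) : Γ.V := Γ.vert t.1.1

theorem insertSub_state (t : Γ.HalfEdgePair) {i : ℕ} {f g : Fin i → Γ.H} (hfg : Γ.IsState f g) :
    Γ.insertSub R t.1.1 t.1.2 (Γ.state R f g) = 0 ∨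
      Γ.IsState (Fin.cons t.1.1 f : Fin (i + 1) → Γ.H) (Fin.cons t.1.2 g : Fin (i + 1) → Γ.H) ∧
        Γ.insertSub R t.1.1 t.1.2 (Γ.state R f g) =
          Γ.state R (Fin.cons t.1.1 f : Fin (i + 1) → Γ.H) (Fin.cons t.1.2 g) := by
  by_cases h : ∃ j, Γ.vert (f j) = t.base
  · obtain ⟨j, hj⟩ := h
    left
    rw [insertSub_apply, killAt_state_of_eq R j hj ((hfg.1 j).symm.trans hj), mul_zero]
  · push Not at h
    refine .inr ⟨⟨Fin.cases t.2 hfg.1, ?_⟩, ?_⟩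
    · have : (fun j => Γ.vert ((Fin.cons t.1.1 f : Fin (i + 1) → Γ.H) j)) =
          (Fin.cons t.base fun j => Γ.vert (f j) : Fin (i + 1) → Γ.V) := by
        funext j
        cases j using Fin.cases <;> rfl
      rw [this, Fin.cons_injective_iff]
      exact ⟨fun ⟨j, hj⟩ => h j hj, hfg.2⟩
    · rw [state_cons, insertSub_apply,
        killAt_state_of_ne R h fun j => by rw [← hfg.1 j]; exact h j]

theorem insertSub_mem_reduced (t : Γ.HalfEdgePair) (z : Γ.HalfEdgeAlgebra R)
    (hz : z ∈ Γ.reduced R) : Γ.insertSub R t.1.1 t.1.2 z ∈ Γ.reduced R := by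
  unfold reduced at hz
  induction hz using Submodule.span_induction with
  | mem z hz =>
    obtain ⟨i, f, g, hfg, rfl⟩ := hz
    rcases insertSub_state R t hfg with h | ⟨h, h'⟩
    · rw [h]
      exact zero_mem _
    · rw [h']
      exact Submodule.subset_span ⟨_, _, _, h, rfl⟩
  | zero => rw [map_zero]; exact zero_mem _
  | add z z' _ _ h h' => rw [map_add]; exact add_mem h h'
  | smul r z _ h => rw [map_smul]; exact Submodule.smul_mem _ _ h

/-- The restriction of `insertSub` to the reduced complex. -/
noncomputable def reducedInsert (t : Γ.HalfEdgePair) : Γ.reduced R →ₗ[Γ.EdgeRing R] Γ.reduced R :=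
  (Γ.insertSub R t.1.1 t.1.2).restrict (insertSub_mem_reduced R t)

/-- The difference of the edges of a pair of half-edges. -/
noncomputable def edgeSub (t : Γ.HalfEdgePair) : Γ.EdgeRing R :=
  MvPolynomial.X (Γ.edge t.1.1) - MvPolynomial.X (Γ.edge t.1.2)

/-- The restriction of `edgeSubMap` to the reduced complex. -/
noncomputable def reducedMap (t : Γ.HalfEdgePair) : Γ.reduced R →ₗ[Γ.EdgeRing R] Γ.reduced R :=
  edgeSub R t • LinearMap.id - Γ.reducedDiff R ∘ₗ reducedInsert R t -
    reducedInsert R t ∘ₗ Γ.reducedDiff R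

theorem coe_reducedMap (t : Γ.HalfEdgePair) (y : Γ.reduced R) :
    (reducedMap R t y : Γ.HalfEdgeAlgebra R) = Γ.edgeSubMap R t.1.1 t.1.2 y := rfl

theorem reducedDiff_reducedDiff (y : Γ.reduced R) : Γ.reducedDiff R (Γ.reducedDiff R y) = 0 :=
  Subtype.ext (CliffordAlgebra.contractLeft_contractLeft _ _)

theorem reducedInsert_mem (t : Γ.HalfEdgePair) {i c : ℕ} {y : Γ.reduced R}
    (hy : y ∈ Γ.reducedPart R i c) : reducedInsert R t y ∈ Γ.reducedPart R (i + 1) (c + 1) := by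
  induction hy using Submodule.span_induction with
  | mem y hy =>
    obtain ⟨p, a, f, g, hp, rfl, hfg, hy⟩ := hy
    have hcoe : (reducedInsert R t y : Γ.HalfEdgeAlgebra R) =
        p • Γ.insertSub R t.1.1 t.1.2 (Γ.state R f g) := by
      rw [← map_smul, ← hy]
      rfl
    rcases insertSub_state R t hfg with h | ⟨h, h'⟩
    · rw [h, smul_zero] at hcoe
      rw [show reducedInsert R t y = 0 from Subtype.ext hcoe]
      exact zero_mem _
    · exact Submodule.subset_span ⟨p, a, _, _, hp, by omega, h, by rw [hcoe, h']⟩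
  | zero => rw [map_zero]; exact zero_mem _
  | add z z' _ _ h h' => rw [map_add]; exact add_mem h h'
  | smul r z _ h => rw [LinearMap.map_smul_of_tower]; exact Submodule.smul_mem _ _ h

theorem mem_reducedPart_of_mem_stateSpan {i a : ℕ} {w : Fin i → Γ.V} (hw : Function.Injective w)
    {y : Γ.reduced R} (hy : (y : Γ.HalfEdgeAlgebra R) ∈ Γ.stateSpan R w a) :
    y ∈ Γ.reducedPart R i (a + i) := by
  have hle : Γ.stateSpan R w a ≤
      (Γ.reducedPart R i (a + i)).map ((Γ.reduced R).subtype.restrictScalars R) := by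
    refine Submodule.span_le.mpr ?_
    rintro _ ⟨p, f, g, hp, hf, hg, rfl⟩
    have hfg : Γ.IsState f g :=
      ⟨fun j => (hf j).trans (hg j).symm, by rwa [funext hf]⟩
    exact ⟨⟨p • Γ.state R f g, Submodule.smul_mem _ _ (Submodule.subset_span ⟨i, f, g, hfg, rfl⟩)⟩,
      Submodule.subset_span ⟨p, a, f, g, hp, rfl, hfg, rfl⟩, rfl⟩
  obtain ⟨y', hy', h⟩ := hle hy
  rwa [← Subtype.ext h]

theorem exists_mem_stateSpan_of_generator {i a : ℕ} {p : Γ.EdgeRing R} (hp : p.IsHomogeneous a)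
    {f g : Fin i → Γ.H} (hfg : Γ.IsState f g) :
    p • Γ.state R f g ∈ Γ.stateSpan R (fun j => Γ.vert (f j)) a :=
  Submodule.subset_span ⟨p, f, g, hp, fun _ => rfl, fun j => (hfg.1 j).symm, rfl⟩

theorem reducedMap_mem (t : Γ.HalfEdgePair) {i c : ℕ} {y : Γ.reduced R}
    (hy : y ∈ Γ.reducedPart R i c) : reducedMap R t y ∈ Γ.reducedPart R i (c + 1) := by
  induction hy using Submodule.span_induction with
  | mem y hy =>
    obtain ⟨p, a, f, g, hp, rfl, hfg, hy⟩ := hy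
    rw [add_right_comm]
    refine mem_reducedPart_of_mem_stateSpan R hfg.2 ?_
    rw [coe_reducedMap, hy]
    exact edgeSubMap_mem_stateSpan R t.2 hfg.2 (exists_mem_stateSpan_of_generator R hp hfg)
  | zero => rw [map_zero]; exact zero_mem _
  | add z z' _ _ h h' => rw [map_add]; exact add_mem h h'
  | smul r z _ h => rw [LinearMap.map_smul_of_tower]; exact Submodule.smul_mem _ _ h

/-- A composite of chain maps `reducedMap` preserves the set of vertices of a state, and kills the
state if one of the maps belongs to a vertex at which the state is empty. -/
theorem prod_reducedMap_mem (l : List Γ.HalfEdgePair) {i a : ℕ} {w : Fin i → Γ.V}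
    (hw : Function.Injective w) {y : Γ.reduced R}
    (hy : (y : Γ.HalfEdgeAlgebra R) ∈ Γ.stateSpan R w a) :
    ((l.map (reducedMap R)).prod y : Γ.HalfEdgeAlgebra R) ∈ Γ.stateSpan R w (a + l.length) ∧
      ((∃ t ∈ l, t.base ∉ Set.range w) → (l.map (reducedMap R)).prod y = 0) := by
  induction l with
  | nil => exact ⟨hy, fun ⟨t, ht, _⟩ => absurd ht List.not_mem_nil⟩
  | cons t l ih =>
    rw [List.map_cons, List.prod_cons, Module.End.mul_apply]
    refine ⟨edgeSubMap_mem_stateSpan R t.2 hw ih.1, ?_⟩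
    rintro ⟨s, hs, hsw⟩
    rcases List.mem_cons.mp hs with rfl | hs
    · exact Subtype.ext (edgeSubMap_eq_zero R s.2 hw hsw ih.1)
    · rw [ih.2 ⟨s, hs, hsw⟩, map_zero]

/-- In degree `i`, the composite of more than `i` of the chain maps at distinct vertices vanishes,
because a state of degree `i` is empty at one of these vertices. -/
theorem prod_reducedMap_eq_zero (l : List Γ.HalfEdgePair)
    (hl : (l.map HalfEdgePair.base).Nodup) {i c : ℕ} (hi : i < l.length) {y : Γ.reduced R}
    (hy : y ∈ Γ.reducedPart R i c) : (l.map (reducedMap R)).prod y = 0 := by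
  classical
  induction hy using Submodule.span_induction with
  | mem y hy =>
    obtain ⟨p, a, f, g, hp, rfl, hfg, hy⟩ := hy
    refine (prod_reducedMap_mem R l hfg.2 (a := a) ?_).2 ?_
    · rw [hy]
      exact exists_mem_stateSpan_of_generator R hp hfg
    · by_contra! h
      have hsub : (l.map HalfEdgePair.base).toFinset ⊆
          Finset.univ.image fun j => Γ.vert (f j) := by
        intro x hx
        obtain ⟨t, ht, rfl⟩ := List.mem_map.mp (List.mem_toFinset.mp hx)
        obtain ⟨j, hj⟩ := h t ht
        exact Finset.mem_image.mpr ⟨j, Finset.mem_univ _, hj⟩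
      have := (Finset.card_le_card hsub).trans Finset.card_image_le
      rw [List.toFinset_card_of_nodup hl, List.length_map, Finset.card_univ,
        Fintype.card_fin] at this
      omega
  | zero => rw [map_zero]
  | add z z' _ _ h h' => rw [map_add, h, h', add_zero]
  | smul r z _ h => rw [LinearMap.map_smul_of_tower, h, smul_zero]

end Reduced

/-! ### The annihilator of the homology -/

section Sink

variable {Γ : FinGraph.{u}} {W : Set Γ.V} (R : Type v) [CommRing R]

theorem baseChange_mem_sinkPart
    {f : (Γ.explode W).reduced R →ₗ[(Γ.explode W).EdgeRing R] (Γ.explode W).reduced R} {i i' : ℕ}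
    (hf : ∀ c, ∀ y ∈ (Γ.explode W).reducedPart R i c, f y ∈ (Γ.explode W).reducedPart R i' (c + 1))
    {k : ℕ} {z : Γ.SinkComplex W R} (hz : z ∈ Γ.sinkPart W R i k) :
    f.baseChange (Γ.SinkRing W R) z ∈ Γ.sinkPart W R i' (k + 1) := by
  induction hz using Submodule.span_induction with
  | mem z hz =>
    obtain ⟨q, b, y, c, hq, hy, rfl, rfl⟩ := hz
    exact Submodule.subset_span ⟨q, b, f y, c + 1, hq, hf c y hy, by omega, rfl⟩
  | zero => rw [map_zero]; exact zero_mem _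
  | add z z' _ _ h h' => rw [map_add]; exact add_mem h h'
  | smul r z _ h => rw [LinearMap.map_smul_of_tower]; exact Submodule.smul_mem _ _ h

theorem smul_mem_sinkPart {q : Γ.SinkRing W R} {b i k : ℕ} (hq : q.IsHomogeneous b)
    {z : Γ.SinkComplex W R} (hz : z ∈ Γ.sinkPart W R i k) :
    q • z ∈ Γ.sinkPart W R i (k + b) := by
  induction hz using Submodule.span_induction with
  | mem z hz =>
    obtain ⟨r, a, y, c, hr, hy, rfl, rfl⟩ := hz
    exact Submodule.subset_span ⟨q * r, b + a, y, c, hq.mul hr, hy, by omega, rfl⟩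
  | zero => rw [smul_zero]; exact zero_mem _
  | add z z' _ _ h h' => rw [smul_add]; exact add_mem h h'
  | smul r z _ h => rw [smul_comm]; exact Submodule.smul_mem _ _ h

theorem sinkDiff_smul (q : Γ.SinkRing W R) (z : Γ.SinkComplex W R) :
    Γ.sinkDiff W R (q • z) = q • Γ.sinkDiff W R z :=
  map_smul (((Γ.explode W).reducedDiff R).baseChange (Γ.SinkRing W R)) q z

theorem sinkDiff_sinkDiff (z : Γ.SinkComplex W R) : Γ.sinkDiff W R (Γ.sinkDiff W R z) = 0 := by
  induction z using TensorProduct.induction_on with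
  | zero => rw [map_zero, map_zero]
  | tmul q y =>
    change q ⊗ₜ (Γ.explode W).reducedDiff R ((Γ.explode W).reducedDiff R y) = 0
    rw [reducedDiff_reducedDiff, TensorProduct.tmul_zero]
  | add z z' h h' => rw [map_add, map_add, h, h', add_zero]

/-- The difference of the edge classes of a pair of half-edges. -/
noncomputable def sinkEdgeSub (t : (Γ.explode W).HalfEdgePair) : Γ.SinkRing W R :=
  MvPolynomial.X (Quotient.mk (Γ.edgeSetoid Wᶜ) (Γ.edge t.1.1)) -
    MvPolynomial.X (Quotient.mk (Γ.edgeSetoid Wᶜ) (Γ.edge t.1.2))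

/-- The map induced by `reducedMap` after base change. -/
noncomputable def sinkMap (t : (Γ.explode W).HalfEdgePair) :
    Γ.SinkComplex W R →ₗ[Γ.SinkRing W R] Γ.SinkComplex W R :=
  (reducedMap R t).baseChange (Γ.SinkRing W R)

/-- The homotopy induced by `reducedInsert` after base change. -/
noncomputable def sinkInsert (t : (Γ.explode W).HalfEdgePair) :
    Γ.SinkComplex W R →ₗ[Γ.SinkRing W R] Γ.SinkComplex W R :=
  (reducedInsert R t).baseChange (Γ.SinkRing W R)

theorem algebraMap_edgeSub (t : (Γ.explode W).HalfEdgePair) :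
    algebraMap ((Γ.explode W).EdgeRing R) (Γ.SinkRing W R) (edgeSub R t) = sinkEdgeSub R t := by
  change MvPolynomial.rename _ (edgeSub R t) = _
  rw [edgeSub, map_sub, MvPolynomial.rename_X, MvPolynomial.rename_X, sinkEdgeSub]

theorem sinkMap_apply (t : (Γ.explode W).HalfEdgePair) (z : Γ.SinkComplex W R) :
    sinkMap R t z = sinkEdgeSub R t • z - Γ.sinkDiff W R (sinkInsert R t z) -
      sinkInsert R t (Γ.sinkDiff W R z) := by
  induction z using TensorProduct.induction_on with
  | zero => simp only [map_zero, smul_zero, sub_zero]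
  | tmul q y =>
    change q ⊗ₜ (edgeSub R t • y - (Γ.explode W).reducedDiff R (reducedInsert R t y) -
      reducedInsert R t ((Γ.explode W).reducedDiff R y)) = _
    rw [TensorProduct.tmul_sub, TensorProduct.tmul_sub, ← TensorProduct.smul_tmul,
      Algebra.smul_def, algebraMap_edgeSub]
    rfl
  | add z z' h h' =>
    simp only [map_add, smul_add, h, h']
    abel

theorem sinkMap_mem_sinkCycles (t : (Γ.explode W).HalfEdgePair) {i k : ℕ}
    {z : Γ.SinkComplex W R} (hz : z ∈ Γ.sinkCycles W R i k) :
    sinkMap R t z ∈ Γ.sinkCycles W R i (k + 1) := by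
  refine ⟨baseChange_mem_sinkPart R (fun c y hy => reducedMap_mem R t hy) hz.1, ?_⟩
  have h0 : Γ.sinkDiff W R z = 0 := hz.2
  rw [SetLike.mem_coe, LinearMap.mem_ker, sinkMap_apply, map_sub, map_sub, sinkDiff_smul,
    sinkDiff_sinkDiff, h0, map_zero, map_zero, smul_zero, sub_zero, sub_zero]

theorem smul_sub_sinkMap_mem (t : (Γ.explode W).HalfEdgePair) {i k : ℕ}
    {z : Γ.SinkComplex W R} (hz : z ∈ Γ.sinkCycles W R i k) :
    sinkEdgeSub R t • z - sinkMap R t z ∈ Γ.sinkBoundaries W R i (k + 1) := by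
  refine ⟨sinkInsert R t z,
    baseChange_mem_sinkPart R (fun c y hy => reducedInsert_mem R t hy) hz.1, ?_⟩
  have h0 : Γ.sinkDiff W R z = 0 := hz.2
  rw [sinkMap_apply, h0, map_zero]
  abel

theorem smul_mem_sinkCycles {q : Γ.SinkRing W R} (hq : q.IsHomogeneous 1) {i k : ℕ}
    {z : Γ.SinkComplex W R} (hz : z ∈ Γ.sinkCycles W R i k) :
    q • z ∈ Γ.sinkCycles W R i (k + 1) := by
  refine ⟨smul_mem_sinkPart R hq hz.1, ?_⟩
  rw [SetLike.mem_coe, LinearMap.mem_ker, sinkDiff_smul, LinearMap.mem_ker.mp hz.2, smul_zero]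

theorem smul_mem_sinkBoundaries {q : Γ.SinkRing W R} (hq : q.IsHomogeneous 1) {i k : ℕ}
    {z : Γ.SinkComplex W R} (hz : z ∈ Γ.sinkBoundaries W R i k) :
    q • z ∈ Γ.sinkBoundaries W R i (k + 1) := by
  obtain ⟨y, hy, rfl⟩ := hz
  exact ⟨q • y, smul_mem_sinkPart R hq hy, sinkDiff_smul R q y⟩

theorem isHomogeneous_sinkEdgeSub (t : (Γ.explode W).HalfEdgePair) :
    (sinkEdgeSub R t).IsHomogeneous 1 :=
  (MvPolynomial.isHomogeneous_X R _).sub (MvPolynomial.isHomogeneous_X R _)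

theorem prod_sinkMap (l : List (Γ.explode W).HalfEdgePair) {i k : ℕ}
    {z : Γ.SinkComplex W R} (hz : z ∈ Γ.sinkCycles W R i k) :
    (l.map (sinkMap R)).prod z ∈ Γ.sinkCycles W R i (k + l.length) ∧
      (l.map (sinkEdgeSub R)).prod • z - (l.map (sinkMap R)).prod z ∈
        Γ.sinkBoundaries W R i (k + l.length) := by
  induction l with
  | nil => exact ⟨hz, by simp [zero_mem]⟩
  | cons t l ih =>
    rw [List.map_cons, List.prod_cons, Module.End.mul_apply, List.map_cons, List.prod_cons,
      mul_smul]
    refine ⟨sinkMap_mem_sinkCycles R t ih.1, ?_⟩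
    have h1 := smul_mem_sinkBoundaries R (isHomogeneous_sinkEdgeSub R t) ih.2
    have h2 := smul_sub_sinkMap_mem R t ih.1
    rw [smul_sub] at h1
    have := add_mem h1 h2
    rwa [sub_add_sub_cancel] at this

/-- A product of more than `i` differences `e(h) - e(h')` at distinct vertices is zero on the
homology in degree `i`. -/
theorem prod_smul_mem_sinkBoundaries (l : List (Γ.explode W).HalfEdgePair)
    (hl : (l.map HalfEdgePair.base).Nodup) {i k : ℕ} (hi : i < l.length)
    {z : Γ.SinkComplex W R} (hz : z ∈ Γ.sinkCycles W R i k) :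
    (l.map (sinkEdgeSub R)).prod • z ∈ Γ.sinkBoundaries W R i (k + l.length) := by
  have htmul : ∀ (l : List (Γ.explode W).HalfEdgePair) (q : Γ.SinkRing W R)
      (y : (Γ.explode W).reduced R),
      (l.map (sinkMap R)).prod (q ⊗ₜ[(Γ.explode W).EdgeRing R] y : Γ.SinkComplex W R) =
        q ⊗ₜ (l.map (reducedMap R)).prod y := by
    intro l q y
    induction l with
    | nil => rfl
    | cons t l ih =>
      rw [List.map_cons, List.prod_cons, Module.End.mul_apply, ih]
      rfl
  have h0 : ∀ x ∈ Γ.sinkPart W R i k, (l.map (sinkMap R)).prod x = 0 := by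
    intro x hx
    induction hx using Submodule.span_induction with
    | mem x hx =>
      obtain ⟨q, b, y, c, -, hy, -, rfl⟩ := hx
      rw [htmul, prod_reducedMap_eq_zero R l hl hi hy, TensorProduct.tmul_zero]
    | zero => rw [map_zero]
    | add z z' _ _ h h' => rw [map_add, h, h', add_zero]
    | smul r z _ h => rw [LinearMap.map_smul_of_tower, h, smul_zero]
  have := (prod_sinkMap R l hz).2
  rwa [h0 z hz.1, sub_zero] at this

end Sink

end FinGraph

namespace FinGraph

/-! ### Vertices, edge classes and the conclusion -/

section Growth

variable {Γ : FinGraph.{u}} {W : Set Γ.V} (F : Type v) [Field F]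

theorem explode_vert_of_notMem {h : Γ.H} (hW : Γ.vert h ∉ W) :
    (Γ.explode W).vert h = Sum.inl ⟨Γ.vert h, hW⟩ := dif_neg hW

theorem explode_vert_eq {h h' : Γ.H} (hne : h ≠ h')
    (hv : (Γ.explode W).vert h = (Γ.explode W).vert h') :
    Γ.vert h ∉ W ∧ Γ.vert h = Γ.vert h' := by
  simp only [explode] at hv
  split_ifs at hv with h1 h2 h2
  · exact absurd (congrArg Subtype.val (Sum.inr_injective hv)) hne
  · exact ⟨h1, congrArg Subtype.val (Sum.inl_injective hv)⟩

theorem explode_vert_inj {h h' : Γ.H} (hW : Γ.vert h ∉ W) (hW' : Γ.vert h' ∉ W) :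
    (Γ.explode W).vert h = (Γ.explode W).vert h' ↔ Γ.vert h = Γ.vert h' := by
  rw [explode_vert_of_notMem hW, explode_vert_of_notMem hW']
  exact ⟨fun h => congrArg Subtype.val (Sum.inl_injective h),
    fun h => congrArg Sum.inl (Subtype.ext h)⟩

theorem two_le_valence {h h' : Γ.H} (hne : h ≠ h') (hv : Γ.vert h = Γ.vert h') :
    2 ≤ Γ.valence (Γ.vert h) :=
  Finite.one_lt_card_iff_nontrivial.mpr
    ⟨⟨h, rfl⟩, ⟨h', hv.symm⟩, fun heq => hne (congrArg Subtype.val heq)⟩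

theorem card_edgeClass_mono {S T : Set Γ.V} (h : S ⊆ T) :
    Nat.card (Γ.EdgeClass S) ≤ Nat.card (Γ.EdgeClass T) := by
  refine Nat.card_le_card_of_surjective (Quotient.map id ?_ : Γ.EdgeClass T → Γ.EdgeClass S) ?_
  · refine fun e e' hee' => Relation.EqvGen.mono ?_ e e' hee'
    rintro _ _ ⟨a, b, hab, ha, h1, h2⟩
    exact ⟨a, b, hab, fun hS => ha (h hS), h1, h2⟩
  · rintro ⟨e⟩
    exact ⟨Quotient.mk _ e, rfl⟩

variable (Γ W) in
/-- The states of degree `i` of the exploded graph. -/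
abbrev SinkState (i : ℕ) : Type u :=
  {s : (Fin i → Γ.H) × (Fin i → Γ.H) // (Γ.explode W).IsState s.1 s.2}

/-- The element of `S̃_W(Γ; F)` given by a state. -/
noncomputable def sinkState {i : ℕ} (s : Γ.SinkState W i) : Γ.SinkComplex W F :=
  1 ⊗ₜ (⟨(Γ.explode W).state F s.1.1 s.1.2, Submodule.subset_span ⟨i, _, _, s.2, rfl⟩⟩ :
    (Γ.explode W).reduced F)

open Classical in
theorem sinkPart_le_homogeneousSpan (i k : ℕ) : Γ.sinkPart W F i k ≤
    homogeneousSpan F (Γ.EdgeClass Wᶜ) (sinkState F : Γ.SinkState W i → _) i k := by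
  refine Submodule.span_le.mpr ?_
  rintro _ ⟨q, b, y, c, hq, hy, rfl, rfl⟩
  induction hy using Submodule.span_induction with
  | mem y hy =>
    obtain ⟨p, a, f, g, hp, rfl, hfg, hy⟩ := hy
    refine Submodule.subset_span ⟨MvPolynomial.rename (Quotient.mk (Γ.edgeSetoid Wᶜ)) p * q, a + b,
      ⟨(f, g), hfg⟩, hp.rename_isHomogeneous.mul hq, by omega, ?_⟩
    have hy' : y = p • (⟨(Γ.explode W).state F f g,
        Submodule.subset_span ⟨i, _, _, hfg, rfl⟩⟩ : (Γ.explode W).reduced F) := Subtype.ext hy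
    rw [hy', ← TensorProduct.smul_tmul, Algebra.smul_def, sinkState, TensorProduct.smul_tmul',
      smul_eq_mul, mul_one]
    rfl
  | zero => rw [TensorProduct.tmul_zero]; exact zero_mem _
  | add z z' _ _ h h' => rw [TensorProduct.tmul_add]; exact add_mem h h'
  | smul r z _ h =>
    rw [TensorProduct.tmul_smul]
    exact Submodule.smul_mem _ _ h

open Classical in
/-- A nonzero state of degree `i` occupies `i` distinct vertices of valence at least two. -/
theorem sinkState_eq_zero {i : ℕ}
    (hi : (Finset.univ.filter fun x : Γ.V => 2 ≤ Γ.valence x).card < i) (s : Γ.SinkState W i) :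
    sinkState F s = 0 := by
  obtain ⟨⟨f, g⟩, hfg⟩ := s
  suffices h : ∃ j, f j = g j by
    obtain ⟨j, hj⟩ := h
    have : (Γ.explode W).state F f g = 0 :=
      AlternatingMap.map_coord_zero _ j (by rw [hj, sub_self])
    rw [sinkState]
    simp only [this]
    exact TensorProduct.tmul_zero _ _
  by_contra! hne
  have hv := fun j => explode_vert_eq (hne j) (hfg.1 j)
  have hle := Finset.card_le_card_of_injOn (s := Finset.univ) (fun j => Γ.vert (f j))
    (t := Finset.univ.filter fun x : Γ.V => 2 ≤ Γ.valence x)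
    (fun j _ => by simpa using two_le_valence (hne j) (hv j).2) 
    fun j _ j' _ hj => hfg.2 ((explode_vert_inj (hv j).1 (hv j').1).mpr hj)
  rw [Finset.card_univ, Fintype.card_fin] at hle
  omega

/-- If the edges sharing a vertex outside `T` act in the same way on `N' / N`, then the Hilbert
function of `N' / N` is bounded by the number of components of the complement of `T`. -/
theorem eventuallyPoly_hilb_card_edgeClass {L : Type*} [AddCommGroup L] [Module F L]
    [Module (Γ.SinkRing W F) L] [IsScalarTower F (Γ.SinkRing W F) L] {N N' P : ℕ → Submodule F L}
    (hP : BoundedlyGenerated (Γ.EdgeClass Wᶜ) P) (hfin : ∀ k, FiniteDimensional F (P k))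
    (hN : IsGradedSeq (σ := Γ.EdgeClass Wᶜ) N) (hN' : IsGradedSeq (σ := Γ.EdgeClass Wᶜ) N')
    (hle : N ≤ N') (hle' : N' ≤ P) (T : Set Γ.V)
    (hT : ∀ h h' : Γ.H, h ≠ h' → Γ.vert h = Γ.vert h' → Γ.vert h ∉ W → Γ.vert h ∉ T →
      Kills (MvPolynomial.X (Quotient.mk (Γ.edgeSetoid Wᶜ) (Γ.edge h)) -
        MvPolynomial.X (Quotient.mk (Γ.edgeSetoid Wᶜ) (Γ.edge h')) : Γ.SinkRing W F) N' N) :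
    EventuallyPoly (Nat.card (Γ.EdgeClass T)) (hilb N N') := by
  classical
  have hzero : Kills (0 : Γ.SinkRing W F) N' N := fun k z _ => by rw [zero_smul]; exact zero_mem _
  have hrel : ∀ e e' : Γ.E, Γ.edgeSetoid T e e' →
      Kills (MvPolynomial.X (Quotient.mk (Γ.edgeSetoid Wᶜ) e) -
        MvPolynomial.X (Quotient.mk (Γ.edgeSetoid Wᶜ) e') : Γ.SinkRing W F) N' N := by
    intro e e' h
    induction h with
    | rel e e' h =>
      obtain ⟨a, b, hab, haT, rfl, rfl⟩ := h
      by_cases haW : Γ.vert a ∈ W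
      · rw [Quotient.sound (s := Γ.edgeSetoid Wᶜ) (Relation.EqvGen.rel _ _
          ⟨a, b, hab, fun h => h haW, rfl, rfl⟩), sub_self]
        exact hzero
      · rcases eq_or_ne a b with rfl | hne
        · rw [sub_self]
          exact hzero
        · exact hT a b hne hab haW haT
    | refl e => rw [sub_self]; exact hzero
    | symm e e' _ ih =>
      intro k z hz
      rw [← neg_sub, neg_smul]
      exact neg_mem (ih k z hz)
    | trans e e' e'' _ _ ih ih' =>
      intro k z hz
      rw [← sub_add_sub_cancel, add_smul]
      exact add_mem (ih k z hz) (ih' k z hz)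
  let _ : Fintype (Γ.EdgeClass T) := Fintype.ofFinite _
  let Y : Finset (Γ.EdgeClass Wᶜ) :=
    Finset.univ.image fun c : Γ.EdgeClass T => Quotient.mk (Γ.edgeSetoid Wᶜ) c.out
  refine (eventuallyPoly_hilb hP hfin Y hN hN' hle hle' ?_).mono ?_
  · rintro ⟨e⟩
    exact .inr ⟨_, Finset.mem_image.mpr ⟨Quotient.mk (Γ.edgeSetoid T) e, Finset.mem_univ _, rfl⟩,
      hrel _ _ ((Γ.edgeSetoid T).symm' (Quotient.mk_out (s := Γ.edgeSetoid T) e))⟩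
  · rw [Nat.card_eq_fintype_card, ← Finset.card_univ]
    exact Finset.card_image_le

variable (W) in
/-- The boundaries among the cycles, as a graded sequence. -/
noncomputable def cycleBoundaries (i k : ℕ) : Submodule F (Γ.SinkComplex W F) :=
  Γ.sinkCycles W F i k ⊓ Γ.sinkBoundaries W F i k

theorem finrank_sinkHomology (i k : ℕ) [FiniteDimensional F (Γ.sinkCycles W F i k)] :
    (Module.finrank F (Γ.SinkHomology W F i k) : ℚ) =
      hilb (cycleBoundaries W F i) (Γ.sinkCycles W F i) k := by
  have h := Submodule.finrank_quotient_add_finrank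
    ((Γ.sinkBoundaries W F i k).submoduleOf (Γ.sinkCycles W F i k))
  rw [hilb, ← h, cycleBoundaries, ← Submodule.map_comap_subtype, Submodule.finrank_map_subtype_eq]
  push_cast
  exact (add_sub_cancel_right _ _).symm

open Classical in
/-- By `prod_smul_mem_sinkBoundaries` the dévissage starts with `m = i + 1`; a set of at most `i`
labels that it meets is enlarged to one of exactly `i` vertices, which does not decrease the number
of edge classes. -/
theorem eventuallyPoly_sinkHomology (i d : ℕ)
    (hi : i ≤ (Finset.univ.filter fun x : Γ.V => 2 ≤ Γ.valence x).card)
    (hd : ∀ T : Finset Γ.V, (∀ x ∈ T, 2 ≤ Γ.valence x) → T.card = i →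
      Nat.card (Γ.EdgeClass (T : Set Γ.V)) ≤ d) :
    EventuallyPoly d (hilb (cycleBoundaries W F i) (Γ.sinkCycles W F i)) := by
  have hZ : IsGradedSeq (σ := Γ.EdgeClass Wᶜ) (Γ.sinkCycles W F i) := fun e k z hz =>
    smul_mem_sinkCycles F (MvPolynomial.isHomogeneous_X F e) hz
  have hB : IsGradedSeq (σ := Γ.EdgeClass Wᶜ) (cycleBoundaries W F i) := fun e k z hz =>
    ⟨hZ e k z hz.1, smul_mem_sinkBoundaries F (MvPolynomial.isHomogeneous_X F e) hz.2⟩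
  -- Each form is a difference of two half-edges at one vertex, and carries that vertex as label.
  let τ := {t : Γ.H × Γ.H // t.1 ≠ t.2 ∧ Γ.vert t.1 = Γ.vert t.2 ∧ Γ.vert t.1 ∉ W}
  let pair : τ → (Γ.explode W).HalfEdgePair := fun t => ⟨t.1,
    (explode_vert_inj t.2.2.2 (t.2.2.1 ▸ t.2.2.2)).mpr t.2.2.1⟩
  let mk : Γ.E → Γ.EdgeClass Wᶜ := Quotient.mk (Γ.edgeSetoid Wᶜ)
  refine eventuallyPoly_hilb_of_prod
    (P := homogeneousSpan F (Γ.EdgeClass Wᶜ) (sinkState F : Γ.SinkState W i → _) i)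
    (fun t : τ => mk (Γ.edge t.1.1)) (fun t => mk (Γ.edge t.1.2)) (fun t => Γ.vert t.1.1) i d ?_
    Finset.univ.toList (i + 1) ∅ (by simp) (by simp) hB hZ (fun k => inf_le_left)
    (fun k => inf_le_left.trans (sinkPart_le_homogeneousSpan F i k))
    (fun t _ => .inl (Finset.mem_toList.mpr (Finset.mem_univ t))) ?_
  · intro T N N' hTi hT hN hN' hle hle' hkill
    have hT2 : T ⊆ Finset.univ.filter fun x : Γ.V => 2 ≤ Γ.valence x := by
      intro x hx
      obtain ⟨t, rfl⟩ := hT hx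
      simpa using two_le_valence t.2.1 t.2.2.1
    obtain ⟨T', hTT', hT'2, hT'i⟩ := Finset.exists_subsuperset_card_eq hT2 hTi hi
    refine (eventuallyPoly_hilb_card_edgeClass F (boundedlyGenerated_homogeneousSpan _ i)
      (finiteDimensional_homogeneousSpan _ i) hN hN' hle hle' (T : Set Γ.V)
      fun h h' hne hv hW hhT => hkill ⟨(h, h'), hne, hv, hW⟩ hhT).mono ?_
    exact (card_edgeClass_mono (Finset.coe_subset.mpr hTT')).trans
      (hd T' (fun x hx => by simpa using hT'2 hx) hT'i)
  · intro s hs _ k z hz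
    have hnodup : ((List.ofFn fun j => pair (s j)).map HalfEdgePair.base).Nodup := by
      rw [List.map_ofFn, List.nodup_ofFn]
      intro j j' hj
      exact hs ((explode_vert_inj (s j).2.2.2 (s j').2.2.2).mp hj)
    have h := prod_smul_mem_sinkBoundaries F _ hnodup (by simp) hz
    have hprod : ((List.ofFn fun j => pair (s j)).map (sinkEdgeSub F)).prod =
        ∏ j, (MvPolynomial.X (mk (Γ.edge (s j).1.1)) - MvPolynomial.X (mk (Γ.edge (s j).1.2)) :
          Γ.SinkRing W F) := by
      rw [List.map_ofFn, List.prod_ofFn]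
      rfl
    rw [List.length_ofFn, hprod] at h
    exact ⟨hZ.prod_sub_smul_mem _ _ hz, h⟩

end Growth

end FinGraph

/-- For a smooth graph `Γ` without isolated vertices, a set `W` of essential vertices and a field
`F`, the dimension of the weight `k` part of `H_i(S̃_W(Γ; F))` is finite and agrees, for all large
`k`, with a polynomial in `k` of degree at most `Δ_Γ^i - 1` (the zero polynomial if `Δ_Γ^i` is `0`
or `-∞`). -/
theorem mainTheorem5 (Γ : FinGraph.{u}) (hsmooth : Γ.IsSmooth) (hiso : Γ.NoIsolatedVertices)
    (W : Set Γ.V) (hW : ∀ x ∈ W, 3 ≤ Γ.valence x) (F : Type v) [Field F] (i : ℕ) :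
    ∃ p : Polynomial ℚ, p.degree + 1 ≤ Γ.ramos i ∧
      ∃ N : ℕ, ∀ k : ℕ, N ≤ k →
        Module.Finite F (Γ.SinkHomology W F i k) ∧
          (Module.finrank F (Γ.SinkHomology W F i k) : ℚ) = p.eval (k : ℚ) := by
  classical
  have hle := FinGraph.sinkPart_le_homogeneousSpan (W := W) F i
  have hfin : ∀ k, FiniteDimensional F (Γ.sinkCycles W F i k) := by
    intro k
    have := finiteDimensional_homogeneousSpan (F := F) (σ := Γ.EdgeClass Wᶜ)
      (FinGraph.sinkState F : Γ.SinkState W i → Γ.SinkComplex W F) i k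
    exact Submodule.finiteDimensional_of_le ((inf_le_left : Γ.sinkCycles W F i k ≤ _).trans (hle k))
  rcases lt_or_ge (Finset.univ.filter fun x : Γ.V => 2 ≤ Γ.valence x).card i with hi | hi
  · -- There are no nonzero states of degree `i`.
    refine ⟨0, by simp, 0, fun k _ => ⟨inferInstance, ?_⟩⟩
    have hbot : Γ.sinkCycles W F i k = ⊥ := by
      refine le_bot_iff.mp (inf_le_left.trans ((hle k).trans (Submodule.span_le.mpr ?_)))
      rintro _ ⟨q, b, s, -, -, rfl⟩
      rw [FinGraph.sinkState_eq_zero F hi s, smul_zero]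
      exact zero_mem _
    have hz : Module.finrank F (Γ.sinkCycles W F i k) = 0 := by rw [hbot, finrank_bot]
    have := Submodule.finrank_quotient_le
      ((Γ.sinkBoundaries W F i k).submoduleOf (Γ.sinkCycles W F i k))
    rw [Polynomial.eval_zero, Nat.cast_eq_zero]
    exact Nat.le_zero.mp (this.trans hz.le)
  · obtain ⟨S, -, hS⟩ := Finset.exists_mem_eq_sup
      ((Finset.univ.filter fun x : Γ.V => 2 ≤ Γ.valence x).powersetCard i)
      (Finset.powersetCard_nonempty.mpr hi)
      (fun S => ((Nat.card (Γ.EdgeClass (S : Set Γ.V)) : ℕ) : WithBot ℕ))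
    have hram : Γ.ramos i = ((Nat.card (Γ.EdgeClass (S : Set Γ.V)) : ℕ) : WithBot ℕ) := hS
    obtain ⟨p, hp, n, hpn⟩ := (FinGraph.eventuallyPoly_sinkHomology (W := W) F i
      (Nat.card (Γ.EdgeClass (S : Set Γ.V))) hi fun T hT hTi => by
        refine WithBot.coe_le_coe.mp (le_of_le_of_eq ?_ hram)
        exact Finset.le_sup (f := fun S : Finset Γ.V =>
          ((Nat.card (Γ.EdgeClass (S : Set Γ.V)) : ℕ) : WithBot ℕ))
          (Finset.mem_powersetCard.mpr ⟨fun x hx => by simpa using hT x hx, hTi⟩)).exists_polynomial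
    refine ⟨p, ?_, n, fun k hk => ⟨inferInstance, ?_⟩⟩
    · rw [hram]
      exact hp
    · rw [FinGraph.finrank_sinkHomology, hpn k hk]
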